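/- Consider the zero-field symmetric bipartite mean-field model with real couplings $J_{11}=J_{22}$ and $J_{12}$, inverse temperature $\beta>0$ and groups of equal size. Its pressure functional is $$f_{J_{12}}(\mu_1,\mu_2)=\beta\Big(\tfrac18 J_{11}\mu_1^2+\tfrac14 J_{12}\mu_1\mu_2+\tfrac18 J_{11}\mu_2^2\Big)-\tfrac12\mathscr I(\mu_1)-\tfrac12\mathscr I(\mu_2),\qquad \mathscr I(x)=\tfrac12\big((1+x)\ln(1+x)+(1-x)\ln(1-x)\big).$$ Critical points of $f=f_{J_{12}}$ are the points of the open square $(-1,1)^2$ at which the differential of $f$ vanishes; a maximum (minimum) point is a critical point that is a local maximum (minimum), and an inflection point is a critical point that is neither. Let $\lambda_M$ and $\lambda_m$ be the largest and the smallest eigenvalue of $\begin{pmatrix}J_{11}&J_{12}\\J_{12}&J_{11}\end{pmatrix}$. Suppose that $J_{11}$ and $J_{12}$ have the same sign, i.e. $J_{11}J_{12}>0$. Then for every $\beta>0$ the critical points of $f_{J_{12}}$ are exactly the images of the critical points of $f_{-J_{12}}$ under the reflection $(\mu_1,\mu_2)\mapsto(-\mu_1,\mu_2)$ across the vertical axis,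 and corresponding critical points have the same nature (maximum, minimum or inflection point). Explicitly: 1. If $J_{11}>0$ and $J_{12}>0$, then $\lambda_M=J_{11}+J_{12}$, $\lambda_m=J_{11}-J_{12}$ and: (a) If $0<\beta\le 2/\lambda_M$, the unique critical point is $(0,0)$, and it is a maximum point. (b) If $\beta>2/\lambda_M$ and $\lambda_m<0$, or $2/\lambda_M<\beta<2/\lambda_m$ and $\lambda_m>0$, there are exactly three critical points, $(0,0)$ and $\pm(\tilde x,\tilde x)$, where $\tilde x>0$ solves $\tilde x=\tanh\big(\tfrac{\beta\lambda_M}{2}\tilde x\big)$. The origin is an inflection point and $\pm(\tilde x,\tilde x)$ are maximum points. Suppose $\lambda_m>0$. Then the equation $\dfrac{\check\beta\tanh^{-1}(\sqrt{1-\check\beta})}{\sqrt{1-\check\beta}}=\dfrac{\lambda_m}{\lambda_M}$ has a solution in $(0,1)$, and for any such solution $\check\beta\in(0,1)$: (c) If $2/\lambda_m<\beta<2/(\check\beta\lambda_M)$, there are exactly five critical points, $(0,0)$, $\pm(\tilde x,\tilde x)$ and $\pm(\hat x,-\hat x)$, where $\tilde x$ is as in (b) and $\hat x>0$ solves $\hat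 x=\tanh\big(\tfrac{\beta\lambda_m}{2}\hat x\big)$. The origin is a minimum point, $\pm(\tilde x,\tilde x)$ are maximum points and $\pm(\hat x,-\hat x)$ are inflection points. (d) If $\beta>2/(\check\beta\lambda_M)$, there are exactly nine critical points, $(0,0)$, $\pm(\tilde x,\tilde x)$, $\pm(\hat x,-\hat x)$, $\pm(-x_1^*,x_2^*)$ and $\pm(-x_2^*,x_1^*)$, for some real $x_1^*,x_2^*$, with $\tilde x,\hat x$ as above. The origin is a minimum point, $\pm(\tilde x,\tilde x)$ and $\pm(\hat x,-\hat x)$ are maximum points, and the other four are not maximum points. 2. If $J_{11}<0$ and $J_{12}<-|J_{11}|$, then $\lambda_M=J_{11}-J_{12}>0$, $\lambda_m=J_{11}+J_{12}<0$ and: (a) If $0<\beta<2/\lambda_M$, the unique critical point is $(0,0)$, and it is a maximum point. (b) If $\beta>2/\lambda_M$, there are exactly three critical points, $(0,0)$ and $\pm(\tilde x,-\tilde x)$, where $\tilde x>0$ solves $\tilde x=\tanh\big(\tfrac{\beta\lambda_M}{2}\tilde x\big)$. The origin is an inflection point and $\pm(\tilde x,-\tilde x)$ are maximum points. 3. If $J_{11}<0$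 and $-|J_{11}|<J_{12}<0$, then $\lambda_M=J_{11}-J_{12}<0$, $\lambda_m=J_{11}+J_{12}<0$, and for every $\beta>0$ the unique critical point is $(0,0)$, which is a maximum point. -/

import Mathlib

open Set Filter Topology

/-- The binary entropy term `I(x) = ½((1+x) ln(1+x) + (1-x) ln(1-x))`. -/
noncomputable def spinEntropy (x : ℝ) : ℝ :=
  1 / 2 * ((1 + x) * Real.log (1 + x) + (1 - x) * Real.log (1 - x))

/-- Minus the energy per particle of the bipartite mean-field model, as a function of the two
magnetizations. The first group has relative size `α`, the second one `1 - α`. -/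
noncomputable def energyFunction (α J11 J12 J22 h1 h2 : ℝ) (m : ℝ × ℝ) : ℝ :=
  1 / 2 * (α ^ 2 * J11 * m.1 ^ 2 + 2 * α * (1 - α) * J12 * m.1 * m.2
      + (1 - α) ^ 2 * J22 * m.2 ^ 2)
    + α * h1 * m.1 + (1 - α) * h2 * m.2

/-- The pressure functional `f = β g - α₁ I(μ₁) - α₂ I(μ₂)`. -/
noncomputable def pressureFunctional (β α J11 J12 J22 h1 h2 : ℝ) (m : ℝ × ℝ) : ℝ :=
  β * energyFunction α J11 J12 J22 h1 h2 m
    - α * spinEntropy m.1 - (1 - α) * spinEntropy m.2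

/-- The pressure functional of the symmetric model (`α = 1/2`, `J22 = J11`) in zero field. -/
noncomputable def symPressure (β J11 J12 : ℝ) : ℝ × ℝ → ℝ :=
  pressureFunctional β (1 / 2) J11 J12 J11 0 0

/-- The reduced interaction matrix. -/
def reducedMatrix (J11 J12 J22 : ℝ) : Matrix (Fin 2) (Fin 2) ℝ :=
  !![J11, J12; J12, J22]

/-- The set of (real) eigenvalues of a real 2 × 2 matrix. -/
def eigenvalueSet (A : Matrix (Fin 2) (Fin 2) ℝ) : Set ℝ :=
  {l | Module.End.HasEigenvalue (Matrix.toLin' A) l}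

/-- Critical points: zeros of the differential in the open square `(-1,1)²`, where the pressure
functional is differentiable. -/
def IsCriticalPoint (f : ℝ × ℝ → ℝ) (p : ℝ × ℝ) : Prop :=
  p ∈ Ioo (-1 : ℝ) 1 ×ˢ Ioo (-1 : ℝ) 1 ∧ HasFDerivAt f (0 : ℝ × ℝ →L[ℝ] ℝ) p

/-- The set of all critical points. -/
def criticalSet (f : ℝ × ℝ → ℝ) : Set (ℝ × ℝ) :=
  {p | IsCriticalPoint f p}

/-- A critical point that is a local maximum. -/
def IsMaximumPoint (f : ℝ × ℝ → ℝ) (p : ℝ × ℝ) : Prop :=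
  IsCriticalPoint f p ∧ IsLocalMax f p

/-- A critical point that is a local minimum. -/
def IsMinimumPoint (f : ℝ × ℝ → ℝ) (p : ℝ × ℝ) : Prop :=
  IsCriticalPoint f p ∧ IsLocalMin f p

/-- A critical point that is neither a local maximum nor a local minimum. -/
def IsInflectionPoint (f : ℝ × ℝ → ℝ) (p : ℝ × ℝ) : Prop :=
  IsCriticalPoint f p ∧ ¬ IsLocalMax f p ∧ ¬ IsLocalMin f p

/-- Reflection of the plane across the vertical axis. -/
def reflectVertical (p : ℝ × ℝ) : ℝ × ℝ := (-p.1, p.2)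

/-- `x` is the positive solution of the mean-field equation `x = tanh (β l x / 2)`. -/
def IsPositiveMeanFieldSol (β l x : ℝ) : Prop :=
  0 < x ∧ x = Real.tanh (β * l / 2 * x)

/-- `c ∈ (0,1)` solves `c artanh(√(1-c)) / √(1-c) = r`. -/
def IsThreshold (r c : ℝ) : Prop :=
  c ∈ Ioo (0 : ℝ) 1 ∧ c * Real.artanh (Real.sqrt (1 - c)) / Real.sqrt (1 - c) = r

/-! Write the magnetizations as `(tanh u, tanh v)` and put `P = u + v`, `Q = u - v`, `L = β (J11 +
J12) / 2`, `l = β (J11 - J12) / 2`. Adding and subtracting the two mean-field equations decouples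
the couplings, and clearing denominators gives `P (cosh P + cosh Q) = 2 L P sinhc P` and `Q (cosh P
+ cosh Q) = 2 l Q sinhc Q` (`isCriticalPoint_tanh_iff'`). If `Q = 0` or `P = 0` the point lies on a
diagonal and satisfies `xcoth w = L` or `xcoth w = l`; since `xcoth` increases from 1 on the
half-line, a nonzero solution exists exactly when the constant exceeds 1, and it is unique up to
sign.

If neither vanishes, the system is equivalent to `sinhc Q = r sinhc P`, `xcoth P + r xcoth Q = 2 L`
with `r = L / l`. On the curve given by the first equation, the left side of the second increases
strictly with `P > 0`, starting from `1 + cosh (2t) = 2 cosh² t`, where `sinhc (2t) = r`. So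
off-diagonal points exist only if `cosh² t < L`, and then `|P|` and `|Q|` are determined, which
leaves four points (`exists_pair`, `pair_unique`). The threshold equation says exactly that `c = 1 /
cosh² t` (`IsThreshold.exists_eq`).

The nature of a point is read off the Hessian: the entropy has second derivative `cosh² u` at `tanh
u`, so on the diagonals the signs of `L - cosh² w` and `l - cosh² w` decide. Off the diagonals the
determinant is negative by `cosh_sinhc_ineq`. At the origin with `L = 1` the Hessian is degenerate,
and the global bound `sq_half_le_spinEntropy` replaces it. Negative `J12` reduces to positive `J12`
by reflection, because the entropy is even. -/

/-! ### The functions `sinhc` and `xcoth` -/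

/-- The function `sinh x / x`, extended by `1` at the origin. -/
noncomputable def sinhc : ℝ → ℝ := dslope Real.sinh 0

/-- The function `x coth x`, extended by `1` at the origin. -/
noncomputable def xcoth (x : ℝ) : ℝ := Real.cosh x / sinhc x

lemma sinhc_zero : sinhc 0 = 1 := by simp [sinhc]

lemma sinhc_of_ne {x : ℝ} (hx : x ≠ 0) : sinhc x = Real.sinh x / x := by
  simp [sinhc, dslope_of_ne _ hx, slope_def_field]

lemma mul_sinhc (x : ℝ) : x * sinhc x = Real.sinh x := by
  rcases eq_or_ne x 0 with rfl | hx
  · simp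
  · rw [sinhc_of_ne hx]; field_simp

lemma sinhc_neg (x : ℝ) : sinhc (-x) = sinhc x := by
  rcases eq_or_ne x 0 with rfl | hx
  · simp
  · rw [sinhc_of_ne hx, sinhc_of_ne (neg_ne_zero.2 hx), Real.sinh_neg, neg_div_neg_eq]

lemma sinhc_abs (x : ℝ) : sinhc |x| = sinhc x := by
  rcases abs_choice x with h | h <;> simp [h, sinhc_neg]

lemma continuous_sinhc : Continuous sinhc := by
  rw [continuous_iff_continuousAt]
  intro x
  rcases eq_or_ne x 0 with rfl | hx
  · exact continuousAt_dslope_same.2 Real.differentiable_sinh.differentiableAt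
  · exact (continuousAt_dslope_of_ne hx).2 Real.continuous_sinh.continuousAt

lemma sinh_lt_mul_cosh {x : ℝ} (hx : 0 < x) : Real.sinh x < x * Real.cosh x := by
  have hmono : StrictMonoOn (fun x : ℝ => x * Real.cosh x - Real.sinh x) (Ici 0) := by
    apply strictMonoOn_of_deriv_pos (convex_Ici 0) (by fun_prop)
    intro y hy
    rw [interior_Ici, mem_Ioi] at hy
    have h : HasDerivAt (fun x : ℝ => x * Real.cosh x - Real.sinh x)
        (1 * Real.cosh y + y * Real.sinh y - Real.cosh y) y :=
      ((hasDerivAt_id y).mul (Real.hasDerivAt_cosh y)).sub (Real.hasDerivAt_sinh y)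
    rw [h.deriv]
    have := mul_pos hy (Real.sinh_pos_iff.2 hy)
    linarith
  have := hmono self_mem_Ici hx.le hx
  simp only [zero_mul, Real.sinh_zero, sub_zero] at this
  linarith

lemma sinhc_strictMonoOn : StrictMonoOn sinhc (Ici 0) := by
  apply strictMonoOn_of_deriv_pos (convex_Ici 0) continuous_sinhc.continuousOn
  intro y hy
  rw [interior_Ici, mem_Ioi] at hy
  have h : HasDerivAt (fun x : ℝ => Real.sinh x / x)
      ((Real.cosh y * y - Real.sinh y * 1) / y ^ 2) y :=
    (Real.hasDerivAt_sinh y).div (hasDerivAt_id y) hy.ne'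
  have he : sinhc =ᶠ[𝓝 y] fun x => Real.sinh x / x := by
    filter_upwards [isOpen_ne.mem_nhds hy.ne'] with x hx using sinhc_of_ne hx
  rw [he.deriv_eq, h.deriv]
  have := sinh_lt_mul_cosh hy
  apply div_pos _ (by positivity)
  linarith

lemma one_lt_sinhc {x : ℝ} (hx : x ≠ 0) : 1 < sinhc x := by
  have := sinhc_strictMonoOn self_mem_Ici (abs_nonneg x) (abs_pos.2 hx)
  rwa [sinhc_zero, sinhc_abs] at this

lemma one_le_sinhc (x : ℝ) : 1 ≤ sinhc x := by
  rcases eq_or_ne x 0 with rfl | hx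
  · rw [sinhc_zero]
  · exact (one_lt_sinhc hx).le

lemma sinhc_pos (x : ℝ) : 0 < sinhc x := one_pos.trans_le (one_le_sinhc x)

lemma sinhc_lt_cosh {x : ℝ} (hx : x ≠ 0) : sinhc x < Real.cosh x := by
  have h := sinh_lt_mul_cosh (abs_pos.2 hx)
  rw [← mul_sinhc, sinhc_abs, Real.cosh_abs] at h
  exact lt_of_mul_lt_mul_left h (abs_nonneg x)

lemma sinhc_two_mul (x : ℝ) : sinhc (2 * x) = sinhc x * Real.cosh x := by
  rcases eq_or_ne x 0 with rfl | hx
  · simp [sinhc_zero]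
  · rw [sinhc_of_ne hx, sinhc_of_ne (by positivity), Real.sinh_two_mul]
    field_simp

lemma exists_sinhc_eq {r : ℝ} (hr : 1 ≤ r) : ∃ x, 0 ≤ x ∧ sinhc x = r := by
  -- From `exp x ≥ 1 + x + x² / 2` at `x = 4 r`, `sinh (4 r) ≥ 2 r + 4 r² ≥ r * (4 r)`.
  have hM : r ≤ sinhc (4 * r) := by
    have h4 : (0 : ℝ) < 4 * r := by linarith
    have h1 := Real.quadratic_le_exp_of_nonneg h4.le
    have h2 : Real.exp (-(4 * r)) ≤ 1 := Real.exp_le_one_iff.2 (by linarith)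
    rw [sinhc_of_ne h4.ne', Real.sinh_eq, le_div_iff₀ h4]
    nlinarith
  obtain ⟨x, hx, h⟩ := intermediate_value_Icc (by linarith : (0 : ℝ) ≤ 4 * r)
    continuous_sinhc.continuousOn ⟨by rwa [sinhc_zero], hM⟩
  exact ⟨x, hx.1, h⟩

lemma xcoth_zero : xcoth 0 = 1 := by simp [xcoth, sinhc_zero]

lemma xcoth_neg (x : ℝ) : xcoth (-x) = xcoth x := by simp [xcoth, sinhc_neg]

lemma xcoth_abs (x : ℝ) : xcoth |x| = xcoth x := by simp [xcoth, sinhc_abs]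

lemma continuous_xcoth : Continuous xcoth :=
  Real.continuous_cosh.div continuous_sinhc fun x => (sinhc_pos x).ne'

lemma xcoth_mul_sinhc (x : ℝ) : xcoth x * sinhc x = Real.cosh x :=
  div_mul_cancel₀ _ (sinhc_pos x).ne'

lemma xcoth_of_ne {x : ℝ} (hx : x ≠ 0) : xcoth x = x * Real.cosh x / Real.sinh x := by
  rw [xcoth, ← mul_sinhc x, mul_div_mul_left _ _ hx]

lemma xcoth_mul_tanh (x : ℝ) : xcoth x * Real.tanh x = x := by
  rw [xcoth, Real.tanh_eq_sinh_div_cosh, ← mul_sinhc x]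
  have := (sinhc_pos x).ne'
  have := (Real.cosh_pos x).ne'
  field_simp

/-- The numerator of the derivative simplifies to `sinh y cosh y - y`, which is positive because `y
< sinh y` and `1 < cosh y`. -/
lemma xcoth_strictMonoOn : StrictMonoOn xcoth (Ici 0) := by
  apply strictMonoOn_of_deriv_pos (convex_Ici 0) continuous_xcoth.continuousOn
  intro y hy
  rw [interior_Ici, mem_Ioi] at hy
  have hs : 0 < Real.sinh y := Real.sinh_pos_iff.2 hy
  have h : HasDerivAt (fun x : ℝ => x * Real.cosh x / Real.sinh x)
      (((1 * Real.cosh y + y * Real.sinh y) * Real.sinh y - y * Real.cosh y * Real.cosh y)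
        / Real.sinh y ^ 2) y :=
    ((hasDerivAt_id y).mul (Real.hasDerivAt_cosh y)).div (Real.hasDerivAt_sinh y) hs.ne'
  have he : xcoth =ᶠ[𝓝 y] fun x => x * Real.cosh x / Real.sinh x := by
    filter_upwards [isOpen_ne.mem_nhds hy.ne'] with x hx using xcoth_of_ne hx
  rw [he.deriv_eq, h.deriv]
  apply div_pos _ (by positivity)
  have h1 := Real.self_lt_sinh_iff.2 hy
  have h2 := Real.cosh_sq y
  have h3 := Real.one_lt_cosh.2 hy.ne'
  nlinarith

lemma one_lt_xcoth {x : ℝ} (hx : x ≠ 0) : 1 < xcoth x := by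
  have := xcoth_strictMonoOn self_mem_Ici (abs_nonneg x) (abs_pos.2 hx)
  rwa [xcoth_zero, xcoth_abs] at this

lemma le_xcoth {x : ℝ} (hx : 0 ≤ x) : x ≤ xcoth x := by
  rcases hx.eq_or_lt with rfl | hx
  · simp [xcoth_zero]
  · have hs : 0 < Real.sinh x := Real.sinh_pos_iff.2 hx
    rw [xcoth_of_ne hx.ne', le_div_iff₀ hs]
    exact mul_le_mul_of_nonneg_left (Real.sinh_lt_cosh x).le hx.le

lemma exists_xcoth_eq {r : ℝ} (hr : 1 < r) : ∃ x, 0 < x ∧ xcoth x = r := by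
  obtain ⟨x, hx, h⟩ := intermediate_value_Icc (by linarith : (0 : ℝ) ≤ r)
    continuous_xcoth.continuousOn ⟨by rw [xcoth_zero]; exact hr.le, le_xcoth (by linarith)⟩
  refine ⟨x, hx.1.lt_of_ne ?_, h⟩
  rintro rfl
  rw [xcoth_zero] at h
  linarith

lemma cosh_two_mul_add_one (x : ℝ) : 1 + Real.cosh (2 * x) = 2 * Real.cosh x ^ 2 := by
  rw [Real.cosh_two_mul, Real.sinh_sq]; ring

/-- `1 + cosh (2x) = 2 r sinhc (2x)` is the equation `x coth x = r`. -/
lemma xcoth_mul_sinhc_two_mul (x : ℝ) : xcoth x * sinhc (2 * x) = Real.cosh x ^ 2 := by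
  rw [sinhc_two_mul, ← mul_assoc, xcoth_mul_sinhc, sq]

lemma sinhc_lt_sinhc {x y : ℝ} (hx : 0 ≤ x) (hy : 0 ≤ y) : sinhc x < sinhc y ↔ x < y :=
  sinhc_strictMonoOn.lt_iff_lt hx hy

lemma xcoth_lt_xcoth {x y : ℝ} (hx : 0 ≤ x) (hy : 0 ≤ y) : xcoth x < xcoth y ↔ x < y :=
  xcoth_strictMonoOn.lt_iff_lt hx hy

/-! ### The reduced system off the diagonals -/

/-- The system `sinhc Q = r sinhc P`, `P coth P + r Q coth Q = s` has a solution in the open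
quadrant if the left-hand side of the second equation is less than `s` on the boundary. -/
lemma exists_pair {r s t : ℝ} (hr : 1 < r) (ht : sinhc t = r) (ht0 : 0 ≤ t)
    (hs : 1 + Real.cosh t < s) :
    ∃ P Q, 0 < P ∧ 0 < Q ∧ sinhc Q = r * sinhc P ∧ xcoth P + r * xcoth Q = s := by
  -- Continuing `sinhc` by the line `1 + x` to the left of 0 makes it an order isomorphism of ℝ, so
  -- its inverse is continuous and `Q` becomes a continuous function of `P`.
  have hmono : StrictMono fun x : ℝ => sinhc (max x 0) + min x 0 := by
    intro x y hxy
    rcases lt_or_ge x 0 with hx | hx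
    · have h1 : sinhc (max x 0) ≤ sinhc (max y 0) :=
        sinhc_strictMonoOn.monotoneOn (mem_Ici.2 (le_max_right _ _)) (mem_Ici.2 (le_max_right _ _))
          (max_le_max_right 0 hxy.le)
      have h2 : min x 0 < min y 0 := by
        rw [min_eq_left hx.le]; exact lt_min hxy hx
      exact add_lt_add_of_le_of_lt h1 h2
    · have hy := hx.trans hxy.le
      simp only [max_eq_left hx, max_eq_left hy, min_eq_right hx, min_eq_right hy]
      simpa using (sinhc_lt_sinhc hx hy).2 hxy
  have hsurj : Function.Surjective fun x : ℝ => sinhc (max x 0) + min x 0 := by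
    intro y
    rcases lt_or_ge y 1 with hy | hy
    · refine ⟨y - 1, ?_⟩
      simp [max_eq_right (by linarith : y - 1 ≤ 0), min_eq_left (by linarith : y - 1 ≤ 0),
        sinhc_zero]
    · obtain ⟨x, hx, rfl⟩ := exists_sinhc_eq hy
      exact ⟨x, by simp [max_eq_left hx, min_eq_right hx]⟩
  let e := StrictMono.orderIsoOfSurjective _ hmono hsurj
  have he : ∀ x, 0 ≤ x → e.symm (sinhc x) = x := by
    intro x hx
    rw [e.symm_apply_eq]
    change _ = sinhc (max x 0) + min x 0
    simp [max_eq_left hx, min_eq_right hx]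
  have hlt : ∀ P, 1 < r * sinhc P := fun P => by nlinarith [one_le_sinhc P]
  have hcont : Continuous fun P => xcoth P + r * xcoth (e.symm (r * sinhc P)) :=
    continuous_xcoth.add (continuous_const.mul
      (continuous_xcoth.comp (e.symm.continuous.comp (continuous_const.mul continuous_sinhc))))
  have h0 : xcoth 0 + r * xcoth (e.symm (r * sinhc 0)) = 1 + Real.cosh t := by
    rw [xcoth_zero, sinhc_zero, mul_one, ← ht, he t ht0, mul_comm, xcoth_mul_sinhc]
  have hs0 : 0 ≤ s := by linarith [Real.cosh_pos t]
  -- `P = s` serves as the upper endpoint, because `xcoth s ≥ s` and the other term is positive.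
  have h1 : s ≤ xcoth s + r * xcoth (e.symm (r * sinhc s)) := by
    have : 0 < xcoth (e.symm (r * sinhc s)) := div_pos (Real.cosh_pos _) (sinhc_pos _)
    nlinarith [le_xcoth hs0]
  obtain ⟨P, hP, hPs⟩ := intermediate_value_Icc hs0 hcont.continuousOn ⟨by
    rw [h0]; exact hs.le, h1⟩
  obtain ⟨Q, hQ, hQr⟩ := exists_sinhc_eq (hlt P).le
  refine ⟨P, Q, hP.1.lt_of_ne ?_, hQ.lt_of_ne ?_, hQr, ?_⟩
  · rintro rfl
    simp only [h0] at hPs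
    linarith
  · rintro rfl
    rw [sinhc_zero] at hQr
    linarith [hlt P]
  · simp only [← hQr, he Q hQ] at hPs
    exact hPs

/-- Along `sinhc Q = r sinhc P`, `Q` increases with `P`, hence so does `xcoth P + r xcoth Q`. -/
lemma pair_unique {r s P Q P' Q' : ℝ} (hr : 0 < r) (hP : 0 < P) (hQ : 0 < Q) (hP' : 0 < P')
    (hQ' : 0 < Q') (h1 : sinhc Q = r * sinhc P) (h2 : xcoth P + r * xcoth Q = s)
    (h1' : sinhc Q' = r * sinhc P') (h2' : xcoth P' + r * xcoth Q' = s) : P = P' ∧ Q = Q' := by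
  have key : ∀ {P Q P' Q' : ℝ}, 0 < P → 0 < Q → 0 < P' → 0 < Q' → sinhc Q = r * sinhc P →
      xcoth P + r * xcoth Q = s → sinhc Q' = r * sinhc P' → xcoth P' + r * xcoth Q' = s →
      ¬ P < P' := by
    intro P Q P' Q' hP hQ hP' hQ' h1 h2 h1' h2' h
    have hS := (sinhc_lt_sinhc hP.le hP'.le).2 h
    have hQQ : Q < Q' := by
      rw [← sinhc_lt_sinhc hQ.le hQ'.le, h1, h1']
      exact mul_lt_mul_of_pos_left hS hr
    have h3 := (xcoth_lt_xcoth hP.le hP'.le).2 h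
    have h4 := mul_lt_mul_of_pos_left ((xcoth_lt_xcoth hQ.le hQ'.le).2 hQQ) hr
    linarith
  have hPP : P = P' := le_antisymm (not_lt.1 (key hP' hQ' hP hQ h1' h2' h1 h2))
    (not_lt.1 (key hP hQ hP' hQ' h1 h2 h1' h2'))
  subst hPP
  exact ⟨rfl, sinhc_strictMonoOn.injOn hQ.le hQ'.le (h1.trans h1'.symm)⟩

/-- Two positive numbers `sinhc P < cosh P`, `sinhc Q < cosh Q` satisfy the strict addition
inequality that makes the Hessian of the pressure indefinite off the two diagonals. -/
lemma cosh_sinhc_ineq {P Q : ℝ} (hP : P ≠ 0) (hQ : Q ≠ 0) :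
    (Real.cosh P + Real.cosh Q) * (1 + sinhc P * sinhc Q)
      < (sinhc P + sinhc Q) * (1 + Real.cosh P * Real.cosh Q) := by
  have h1 := one_lt_sinhc hP
  have h2 := one_lt_sinhc hQ
  have h3 := sinhc_lt_cosh hP
  have h4 := sinhc_lt_cosh hQ
  generalize sinhc P = s at *
  generalize sinhc Q = t at *
  generalize Real.cosh P = C at *
  generalize Real.cosh Q = D at *
  -- The right side minus the left side is `(C - s)(D t - 1) + (D - t)(C s - 1)`, with `1 < s < C`
  -- and `1 < t < D`.
  nlinarith [mul_pos (sub_pos.2 h3) (mul_pos (sub_pos.2 h2) (sub_pos.2 (h2.trans h4))),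
    mul_pos (sub_pos.2 h4) (mul_pos (sub_pos.2 h1) (sub_pos.2 (h1.trans h3))),
    mul_pos (sub_pos.2 h3) (sub_pos.2 h4), mul_pos (sub_pos.2 h3) (sub_pos.2 h2),
    mul_pos (sub_pos.2 h4) (sub_pos.2 h1), mul_pos (sub_pos.2 h1) (sub_pos.2 h2),
    mul_pos (sub_pos.2 h3) (mul_pos (sub_pos.2 h4) (sub_pos.2 h1)),
    mul_pos (sub_pos.2 h3) (mul_pos (sub_pos.2 h4) (sub_pos.2 h2))]

/-! ### The entropy and its local quadratic bounds -/

lemma one_sub_tanh_sq_mul_cosh_sq (u : ℝ) : (1 - Real.tanh u ^ 2) * Real.cosh u ^ 2 = 1 := by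
  have := Real.cosh_pos u
  rw [Real.tanh_eq_sinh_div_cosh]
  field_simp
  linarith [Real.cosh_sq u]

lemma tanh_mem_Ioo (u : ℝ) : Real.tanh u ∈ Ioo (-1 : ℝ) 1 :=
  ⟨Real.neg_one_lt_tanh u, Real.tanh_lt_one u⟩

lemma artanh_eq_log_sub_log {x : ℝ} (hx : x ∈ Ioo (-1 : ℝ) 1) :
    Real.artanh x = 1 / 2 * (Real.log (1 + x) - Real.log (1 - x)) := by
  rw [Real.artanh_eq_half_log (Ioo_subset_Icc_self hx),
    Real.log_div (by linarith [hx.1]) (by linarith [hx.2])]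

lemma hasDerivAt_artanh {x : ℝ} (hx : x ∈ Ioo (-1 : ℝ) 1) :
    HasDerivAt Real.artanh (1 - x ^ 2)⁻¹ x := by
  have h1 : (1 : ℝ) + x ≠ 0 := by linarith [hx.1]
  have h2 : (1 : ℝ) - x ≠ 0 := by linarith [hx.2]
  have h : HasDerivAt (fun x : ℝ => 1 / 2 * (Real.log (1 + x) - Real.log (1 - x)))
      (1 / 2 * (1 / (1 + x) - -1 / (1 - x))) x :=
    ((((hasDerivAt_id x).const_add 1).log h1).sub (((hasDerivAt_id x).const_sub 1).log h2)).const_mul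
      _
  have he : Real.artanh =ᶠ[𝓝 x] fun x => 1 / 2 * (Real.log (1 + x) - Real.log (1 - x)) := by
    filter_upwards [isOpen_Ioo.mem_nhds hx] with y hy using artanh_eq_log_sub_log hy
  refine (h.congr_of_eventuallyEq he).congr_deriv ?_
  have h3 : (1 : ℝ) - x ^ 2 = (1 + x) * (1 - x) := by ring
  rw [h3]
  field_simp
  ring

lemma hasDerivAt_spinEntropy {x : ℝ} (hx : x ∈ Ioo (-1 : ℝ) 1) :
    HasDerivAt spinEntropy (Real.artanh x) x := by
  have h1 : (1 : ℝ) + x ≠ 0 := by linarith [hx.1]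
  have h2 : (1 : ℝ) - x ≠ 0 := by linarith [hx.2]
  have d1 := (hasDerivAt_id x).const_add 1
  have d2 := (hasDerivAt_id x).const_sub 1
  have h := ((d1.mul (d1.log h1)).add (d2.mul (d2.log h2))).const_mul (1 / 2)
  refine h.congr_deriv ?_
  rw [artanh_eq_log_sub_log hx]
  simp only [id]
  field_simp
  ring

lemma spinEntropy_neg (x : ℝ) : spinEntropy (-x) = spinEntropy x := by
  simp only [spinEntropy, sub_neg_eq_add, ← sub_eq_add_neg]; ring

lemma spinEntropy_zero : spinEntropy 0 = 0 := by simp [spinEntropy]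

/-- The second-order Taylor defect `I(x) - I(tanh u) - u (x - tanh u) - k/2 (x - tanh u)²` has
vanishing first derivative and second derivative `cosh² u - k` at `tanh u`. -/
lemma spinEntropy_taylor_deriv (u k : ℝ) :
    let g := fun x : ℝ => spinEntropy x - u * (x - Real.tanh u) - k / 2 * (x - Real.tanh u) ^ 2
    ContinuousAt g (Real.tanh u) ∧ deriv g (Real.tanh u) = 0 ∧
      deriv (deriv g) (Real.tanh u) = Real.cosh u ^ 2 - k := by
  intro g
  have hg : ∀ x ∈ Ioo (-1 : ℝ) 1,
      HasDerivAt g (Real.artanh x - u - k * (x - Real.tanh u)) x := by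
    intro x hx
    have hd := (hasDerivAt_id x).sub_const (Real.tanh u)
    refine (((hasDerivAt_spinEntropy hx).sub (hd.const_mul u)).sub
      ((hd.pow 2).const_mul (k / 2))).congr_deriv ?_
    simp
    ring
  have h0 := tanh_mem_Ioo u
  refine ⟨(hg _ h0).continuousAt, ?_, ?_⟩
  · rw [(hg _ h0).deriv, Real.artanh_tanh]; ring
  · have he : deriv g =ᶠ[𝓝 (Real.tanh u)]
        fun x => Real.artanh x - u - k * (x - Real.tanh u) := by
      filter_upwards [isOpen_Ioo.mem_nhds h0] with y hy using (hg y hy).deriv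
    rw [he.deriv_eq]
    have h := ((hasDerivAt_artanh h0).sub_const u).sub
      (((hasDerivAt_id (Real.tanh u)).sub_const (Real.tanh u)).const_mul k)
    refine h.deriv.trans ?_
    have h1 := one_sub_tanh_sq_mul_cosh_sq u
    rw [inv_eq_of_mul_eq_one_right h1, mul_one]

lemma spinEntropy_lower {u k : ℝ} (hk : k < Real.cosh u ^ 2) :
    ∀ᶠ x in 𝓝 (Real.tanh u), spinEntropy (Real.tanh u) + u * (x - Real.tanh u)
      + k / 2 * (x - Real.tanh u) ^ 2 ≤ spinEntropy x := by
  obtain ⟨h1, h2, h3⟩ := spinEntropy_taylor_deriv u k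
  have h := isLocalMin_of_deriv_deriv_pos (by rw [h3]; linarith) h2 h1
  filter_upwards [h] with x hx
  simp only [sub_self] at hx
  linarith

lemma spinEntropy_upper {u k : ℝ} (hk : Real.cosh u ^ 2 < k) :
    ∀ᶠ x in 𝓝 (Real.tanh u), spinEntropy x ≤ spinEntropy (Real.tanh u)
      + u * (x - Real.tanh u) + k / 2 * (x - Real.tanh u) ^ 2 := by
  obtain ⟨h1, h2, h3⟩ := spinEntropy_taylor_deriv u k
  have h := isLocalMax_of_deriv_deriv_neg (by rw [h3]; linarith) h2 h1
  filter_upwards [h] with x hx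
  simp only [sub_self] at hx
  linarith

lemma tanh_le_self {u : ℝ} (hu : 0 ≤ u) : Real.tanh u ≤ u := by
  have h := xcoth_mul_tanh u
  have h1 : 1 ≤ xcoth u := by
    rcases hu.eq_or_lt with rfl | hu
    · rw [xcoth_zero]
    · exact (one_lt_xcoth hu.ne').le
  have h2 : 0 ≤ Real.tanh u := by
    rw [Real.tanh_eq_sinh_div_cosh]
    exact div_nonneg (Real.sinh_nonneg_iff.2 hu) (Real.cosh_pos u).le
  nlinarith

/-- The derivative of the difference is `artanh z - z ≥ 0` on `[0, 1)`, and evenness gives the rest.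
This covers the origin at `L = 1`, where the strict hypothesis of `spinEntropy_lower` with `k = 1`
fails. -/
lemma sq_half_le_spinEntropy {x : ℝ} (hx : x ∈ Ioo (-1 : ℝ) 1) : x ^ 2 / 2 ≤ spinEntropy x := by
  have key : ∀ y ∈ Ico (0 : ℝ) 1, y ^ 2 / 2 ≤ spinEntropy y := by
    intro y hy
    have hd : ∀ z ∈ Ioo (-1 : ℝ) 1,
        HasDerivAt (fun z => spinEntropy z - z ^ 2 / 2) (Real.artanh z - z) z := by
      intro z hz
      refine ((hasDerivAt_spinEntropy hz).sub ((hasDerivAt_pow 2 z).div_const 2)).congr_deriv ?_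
      simp
    have hsub : Ico (0 : ℝ) 1 ⊆ Ioo (-1) 1 := fun z hz => ⟨by linarith [hz.1], hz.2⟩
    have hm : MonotoneOn (fun z => spinEntropy z - z ^ 2 / 2) (Ico 0 1) := by
      apply monotoneOn_of_deriv_nonneg (convex_Ico 0 1)
        (fun z hz => (hd z (hsub hz)).continuousAt.continuousWithinAt)
        (fun z hz => (hd z (hsub (interior_subset hz))).differentiableAt.differentiableWithinAt)
      intro z hz
      have hz' := interior_subset hz
      rw [(hd z (hsub hz')).deriv, sub_nonneg]
      have := tanh_le_self (Real.artanh_nonneg hz'.1)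
      rwa [Real.tanh_artanh (hsub hz')] at this
    have := hm ⟨le_rfl, one_pos⟩ hy hy.1
    simp only [spinEntropy_zero] at this
    linarith
  rcases le_total 0 x with h | h
  · exact key x ⟨h, hx.2⟩
  · have := key (-x) ⟨by linarith, by linarith [hx.1]⟩
    rwa [spinEntropy_neg, neg_sq] at this

/-! ### The pressure functional and its critical equations -/

lemma symPressure_apply (β J11 J12 : ℝ) (m : ℝ × ℝ) :
    symPressure β J11 J12 m
      = 1 / 2 * (β * J11 / 4 * m.1 ^ 2 + β * J12 / 2 * m.1 * m.2 + β * J11 / 4 * m.2 ^ 2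
        - spinEntropy m.1 - spinEntropy m.2) := by
  simp only [symPressure, pressureFunctional, energyFunction]; ring

lemma hasFDerivAt_symPressure (β J11 J12 u v : ℝ) :
    HasFDerivAt (symPressure β J11 J12)
      ((1 / 2 * (β * J11 / 2 * Real.tanh u + β * J12 / 2 * Real.tanh v - u)) •
          ContinuousLinearMap.fst ℝ ℝ ℝ
        + (1 / 2 * (β * J12 / 2 * Real.tanh u + β * J11 / 2 * Real.tanh v - v)) •
          ContinuousLinearMap.snd ℝ ℝ ℝ) (Real.tanh u, Real.tanh v) := by
  set p : ℝ × ℝ := (Real.tanh u, Real.tanh v)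
  have h1 : HasFDerivAt (fun m : ℝ × ℝ => m.1) (ContinuousLinearMap.fst ℝ ℝ ℝ) p := hasFDerivAt_fst
  have h2 : HasFDerivAt (fun m : ℝ × ℝ => m.2) (ContinuousLinearMap.snd ℝ ℝ ℝ) p := hasFDerivAt_snd
  have e1 := (hasDerivAt_spinEntropy (tanh_mem_Ioo u)).comp_hasFDerivAt p h1
  have e2 := (hasDerivAt_spinEntropy (tanh_mem_Ioo v)).comp_hasFDerivAt p h2
  rw [Real.artanh_tanh] at e1 e2
  have h := ((((((h1.mul h1).const_mul (β * J11 / 4)).add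
    ((h1.mul h2).const_mul (β * J12 / 2))).add
    ((h2.mul h2).const_mul (β * J11 / 4))).sub e1).sub e2).const_mul (1 / 2)
  have hf : symPressure β J11 J12 = fun m : ℝ × ℝ => 1 / 2 * (β * J11 / 4 * (m.1 * m.1)
      + β * J12 / 2 * (m.1 * m.2) + β * J11 / 4 * (m.2 * m.2)
        - spinEntropy m.1 - spinEntropy m.2) := by
    ext m; rw [symPressure_apply]; ring
  rw [hf]
  refine h.congr_fderiv ?_
  ext <;> simp [p] <;> ring

lemma isCriticalPoint_tanh_iff (β J11 J12 u v : ℝ) :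
    IsCriticalPoint (symPressure β J11 J12) (Real.tanh u, Real.tanh v) ↔
      u = β * J11 / 2 * Real.tanh u + β * J12 / 2 * Real.tanh v ∧
      v = β * J12 / 2 * Real.tanh u + β * J11 / 2 * Real.tanh v := by
  have h := hasFDerivAt_symPressure β J11 J12 u v
  constructor
  · rintro ⟨-, h0⟩
    have he := h.unique h0
    have e1 := congrArg (fun T : ℝ × ℝ →L[ℝ] ℝ => T (1, 0)) he
    have e2 := congrArg (fun T : ℝ × ℝ →L[ℝ] ℝ => T (0, 1)) he
    simp at e1 e2
    constructor <;> linarith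
  · rintro ⟨e1, e2⟩
    refine ⟨⟨tanh_mem_Ioo u, tanh_mem_Ioo v⟩, h.congr_fderiv ?_⟩
    rw [← e1, ← e2]
    simp

lemma mem_criticalSet_iff (β J11 J12 : ℝ) (p : ℝ × ℝ) :
    p ∈ criticalSet (symPressure β J11 J12) ↔
      ∃ u v, p = (Real.tanh u, Real.tanh v) ∧
        u = β * J11 / 2 * Real.tanh u + β * J12 / 2 * Real.tanh v ∧
        v = β * J12 / 2 * Real.tanh u + β * J11 / 2 * Real.tanh v := by
  constructor
  · intro h
    obtain ⟨⟨h1, h2⟩, -⟩ := id h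
    have hp : p = (Real.tanh (Real.artanh p.1), Real.tanh (Real.artanh p.2)) := by
      rw [Real.tanh_artanh h1, Real.tanh_artanh h2]
    refine ⟨_, _, hp, ?_⟩
    rw [← isCriticalPoint_tanh_iff, ← hp]
    exact h
  · rintro ⟨u, v, rfl, h⟩
    exact (isCriticalPoint_tanh_iff _ _ _ _ _).2 h

/-! ### Second-order tests at a critical point -/

section Nature

variable {β J11 J12 u v : ℝ}

/-- The energy is quadratic, so its expansion is exact, and criticality turns its linear part into
the tangent terms of the two entropies. -/
lemma symPressure_expand
    (hc : IsCriticalPoint (symPressure β J11 J12) (Real.tanh u, Real.tanh v)) (x y : ℝ) :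
    symPressure β J11 J12 (x, y) - symPressure β J11 J12 (Real.tanh u, Real.tanh v)
      = 1 / 2 * (β * J11 / 4 * (x - Real.tanh u) ^ 2
        + β * J12 / 2 * (x - Real.tanh u) * (y - Real.tanh v)
        + β * J11 / 4 * (y - Real.tanh v) ^ 2
        - (spinEntropy x - spinEntropy (Real.tanh u) - u * (x - Real.tanh u))
        - (spinEntropy y - spinEntropy (Real.tanh v) - v * (y - Real.tanh v))) := by
  obtain ⟨h1, h2⟩ := (isCriticalPoint_tanh_iff _ _ _ _ _).1 hc
  rw [symPressure_apply, symPressure_apply]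
  linear_combination 1 / 2 * (x - Real.tanh u) * (-h1) + 1 / 2 * (y - Real.tanh v) * (-h2)

/-- The interaction form has largest eigenvalue `β J11 / 2 + |β J12 / 2|`. The entropy bounds are
hypotheses, and equality with `k` is allowed, so that the degenerate origin is included. -/
lemma isLocalMax_of_forms
    (hc : IsCriticalPoint (symPressure β J11 J12) (Real.tanh u, Real.tanh v)) {k : ℝ}
    (hk : β * J11 / 2 + |β * J12 / 2| ≤ k)
    (hu : ∀ᶠ x in 𝓝 (Real.tanh u), spinEntropy (Real.tanh u) + u * (x - Real.tanh u)
      + k / 2 * (x - Real.tanh u) ^ 2 ≤ spinEntropy x)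
    (hv : ∀ᶠ x in 𝓝 (Real.tanh v), spinEntropy (Real.tanh v) + v * (x - Real.tanh v)
      + k / 2 * (x - Real.tanh v) ^ 2 ≤ spinEntropy x) :
    IsLocalMax (symPressure β J11 J12) (Real.tanh u, Real.tanh v) := by
  filter_upwards [hu.prod_inl_nhds (Real.tanh v), hv.prod_inr_nhds (Real.tanh u)] with ⟨x, y⟩ h1 h2
  simp only at h1 h2
  have h := symPressure_expand hc x y
  generalize x - Real.tanh u = dx at *
  generalize y - Real.tanh v = dy at *
  have h3 := le_abs_self (β * J12 / 2)
  have h4 := neg_abs_le (β * J12 / 2)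
  generalize |β * J12 / 2| = B at *
  nlinarith [mul_nonneg (sub_nonneg.2 h3) (sq_nonneg (dx - dy)),
    mul_nonneg (sub_nonneg.2 h4) (sq_nonneg (dx + dy)),
    mul_nonneg (sub_nonneg.2 hk) (add_nonneg (sq_nonneg dx) (sq_nonneg dy))]

lemma isLocalMax_of_lt_cosh_sq
    (hc : IsCriticalPoint (symPressure β J11 J12) (Real.tanh u, Real.tanh v))
    (hu : β * J11 / 2 + |β * J12 / 2| < Real.cosh u ^ 2)
    (hv : β * J11 / 2 + |β * J12 / 2| < Real.cosh v ^ 2) :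
    IsLocalMax (symPressure β J11 J12) (Real.tanh u, Real.tanh v) :=
  isLocalMax_of_forms hc le_rfl (spinEntropy_lower hu) (spinEntropy_lower hv)

lemma isLocalMin_of_cosh_sq_lt
    (hc : IsCriticalPoint (symPressure β J11 J12) (Real.tanh u, Real.tanh v))
    (hu : Real.cosh u ^ 2 < β * J11 / 2 - |β * J12 / 2|)
    (hv : Real.cosh v ^ 2 < β * J11 / 2 - |β * J12 / 2|) :
    IsLocalMin (symPressure β J11 J12) (Real.tanh u, Real.tanh v) := by
  filter_upwards [(spinEntropy_upper hu).prod_inl_nhds (Real.tanh v),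
    (spinEntropy_upper hv).prod_inr_nhds (Real.tanh u)] with ⟨x, y⟩ h1 h2
  simp only at h1 h2
  have h := symPressure_expand hc x y
  generalize x - Real.tanh u = dx at *
  generalize y - Real.tanh v = dy at *
  have h3 := le_abs_self (β * J12 / 2)
  have h4 := neg_abs_le (β * J12 / 2)
  generalize |β * J12 / 2| = B at *
  nlinarith [mul_nonneg (sub_nonneg.2 h3) (sq_nonneg (dx + dy)),
    mul_nonneg (sub_nonneg.2 h4) (sq_nonneg (dx - dy))]

lemma tendsto_line (p q dx dy : ℝ) :
    Tendsto (fun t : ℝ => (p + t * dx, q + t * dy)) (𝓝[>] 0) (𝓝 (p, q)) := by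
  have h : Continuous fun t : ℝ => (p + t * dx, q + t * dy) := by fun_prop
  have := (h.tendsto 0).mono_left (nhdsWithin_le_nhds (s := Ioi 0))
  simpa using this

/-- Second-order necessary condition at a local maximum. -/
lemma IsLocalMax.hessian_nonpos
    (hc : IsCriticalPoint (symPressure β J11 J12) (Real.tanh u, Real.tanh v))
    (hmax : IsLocalMax (symPressure β J11 J12) (Real.tanh u, Real.tanh v)) (dx dy : ℝ) :
    (β * J11 / 2 - Real.cosh u ^ 2) * dx ^ 2 + 2 * (β * J12 / 2) * dx * dy
      + (β * J11 / 2 - Real.cosh v ^ 2) * dy ^ 2 ≤ 0 := by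
  by_contra! hq
  -- The upper entropy bound needs a constant strictly above `cosh²`; the excess `ε` is chosen so
  -- small that the form stays positive in this direction.
  obtain ⟨ε, hε, hεq⟩ : ∃ ε > 0, ε * (dx ^ 2 + dy ^ 2) <
      (β * J11 / 2 - Real.cosh u ^ 2) * dx ^ 2 + 2 * (β * J12 / 2) * dx * dy
      + (β * J11 / 2 - Real.cosh v ^ 2) * dy ^ 2 :=
    exists_pos_mul_lt hq _ |>.imp fun ε h => ⟨h.1, by rw [mul_comm]; exact h.2⟩
  have hl := tendsto_line (Real.tanh u) (Real.tanh v) dx dy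
  have e1 := hl.eventually ((spinEntropy_upper (lt_add_of_pos_right _ hε)).prod_inl_nhds
    (Real.tanh v))
  have e2 := hl.eventually ((spinEntropy_upper (lt_add_of_pos_right _ hε)).prod_inr_nhds
    (Real.tanh u))
  obtain ⟨t, ⟨⟨h1, h2⟩, h3⟩, ht⟩ :=
    ((e1.and e2).and (hl.eventually hmax) |>.and self_mem_nhdsWithin).exists
  have h := symPressure_expand hc (Real.tanh u + t * dx) (Real.tanh v + t * dy)
  simp only [add_sub_cancel_left] at h h1 h2
  have := mul_pos (pow_pos (mem_Ioi.1 ht) 2) (sub_pos.2 hεq)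
  nlinarith

/-- Second-order necessary condition at a local minimum. -/
lemma IsLocalMin.hessian_nonneg
    (hc : IsCriticalPoint (symPressure β J11 J12) (Real.tanh u, Real.tanh v))
    (hmin : IsLocalMin (symPressure β J11 J12) (Real.tanh u, Real.tanh v)) (dx dy : ℝ) :
    0 ≤ (β * J11 / 2 - Real.cosh u ^ 2) * dx ^ 2 + 2 * (β * J12 / 2) * dx * dy
      + (β * J11 / 2 - Real.cosh v ^ 2) * dy ^ 2 := by
  by_contra! hq
  obtain ⟨ε, hε, hεq⟩ : ∃ ε > 0, ε * (dx ^ 2 + dy ^ 2) <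
      -((β * J11 / 2 - Real.cosh u ^ 2) * dx ^ 2 + 2 * (β * J12 / 2) * dx * dy
      + (β * J11 / 2 - Real.cosh v ^ 2) * dy ^ 2) :=
    exists_pos_mul_lt (neg_pos.2 hq) _ |>.imp fun ε h => ⟨h.1, by rw [mul_comm]; exact h.2⟩
  have hl := tendsto_line (Real.tanh u) (Real.tanh v) dx dy
  have e1 := hl.eventually ((spinEntropy_lower (sub_lt_self _ hε)).prod_inl_nhds
    (Real.tanh v))
  have e2 := hl.eventually ((spinEntropy_lower (sub_lt_self _ hε)).prod_inr_nhds
    (Real.tanh u))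
  obtain ⟨t, ⟨⟨h1, h2⟩, h3⟩, ht⟩ :=
    ((e1.and e2).and (hl.eventually hmin) |>.and self_mem_nhdsWithin).exists
  have h := symPressure_expand hc (Real.tanh u + t * dx) (Real.tanh v + t * dy)
  simp only [add_sub_cancel_left] at h h1 h2
  have := mul_pos (pow_pos (mem_Ioi.1 ht) 2) (sub_pos.2 hεq)
  nlinarith

/-- A local maximum has a Hessian with nonnegative determinant. -/
lemma IsLocalMax.hessian_det_nonneg
    (hc : IsCriticalPoint (symPressure β J11 J12) (Real.tanh u, Real.tanh v))
    (hmax : IsLocalMax (symPressure β J11 J12) (Real.tanh u, Real.tanh v)) :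
    (β * J12 / 2) ^ 2 ≤ (β * J11 / 2 - Real.cosh u ^ 2) * (β * J11 / 2 - Real.cosh v ^ 2) := by
  have h := discrim_le_zero_of_nonpos (a := β * J11 / 2 - Real.cosh u ^ 2)
    (b := 2 * (β * J12 / 2)) (c := β * J11 / 2 - Real.cosh v ^ 2) fun x => by
      have := hmax.hessian_nonpos hc x 1
      linarith
  rw [discrim] at h
  linarith

end Nature

/-! ### Critical points in the coordinates `u + v` and `u - v` -/

lemma tanh_pos {x : ℝ} (hx : 0 < x) : 0 < Real.tanh x := by
  rw [Real.tanh_eq_sinh_div_cosh]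
  exact div_pos (Real.sinh_pos_iff.2 hx) (Real.cosh_pos x)

lemma tanh_lt_tanh {x y : ℝ} (h : x < y) : Real.tanh x < Real.tanh y := by
  by_contra! h'
  have := (Real.artanh_le_artanh_iff (tanh_mem_Ioo y) (tanh_mem_Ioo x)).2 h'
  rw [Real.artanh_tanh, Real.artanh_tanh] at this
  linarith

/-- The common denominator is `2 cosh u cosh v = cosh (u + v) + cosh (u - v)`. -/
lemma tanh_add_tanh (u v : ℝ) :
    (Real.tanh u + Real.tanh v) * (Real.cosh (u + v) + Real.cosh (u - v))
      = 2 * Real.sinh (u + v) := by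
  have h1 := (Real.cosh_pos u).ne'
  have h2 := (Real.cosh_pos v).ne'
  rw [Real.tanh_eq_sinh_div_cosh, Real.tanh_eq_sinh_div_cosh, Real.cosh_add, Real.cosh_sub,
    Real.sinh_add]
  field_simp
  ring

lemma tanh_sub_tanh (u v : ℝ) :
    (Real.tanh u - Real.tanh v) * (Real.cosh (u + v) + Real.cosh (u - v))
      = 2 * Real.sinh (u - v) := by
  have h := tanh_add_tanh u (-v)
  simp only [Real.tanh_neg, sub_neg_eq_add, ← sub_eq_add_neg] at h
  linarith

section Critical

variable {β J11 J12 u v w : ℝ}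

/-- The critical point equations in the coordinates `u + v` and `u - v`. -/
lemma isCriticalPoint_tanh_iff' :
    IsCriticalPoint (symPressure β J11 J12) (Real.tanh u, Real.tanh v) ↔
      (u + v) * (Real.cosh (u + v) + Real.cosh (u - v))
        = (u + v) * (2 * (β * (J11 + J12) / 2) * sinhc (u + v)) ∧
      (u - v) * (Real.cosh (u + v) + Real.cosh (u - v))
        = (u - v) * (2 * (β * (J11 - J12) / 2) * sinhc (u - v)) := by
  have hpos : 0 < Real.cosh (u + v) + Real.cosh (u - v) :=
    add_pos (Real.cosh_pos _) (Real.cosh_pos _)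
  have h1 := tanh_add_tanh u v
  have h2 := tanh_sub_tanh u v
  rw [← mul_sinhc] at h1 h2
  rw [isCriticalPoint_tanh_iff]
  constructor
  · rintro ⟨e1, e2⟩
    constructor
    · linear_combination (Real.cosh (u + v) + Real.cosh (u - v)) * (e1 + e2)
        + β * (J11 + J12) / 2 * h1
    · linear_combination (Real.cosh (u + v) + Real.cosh (u - v)) * (e1 - e2)
        + β * (J11 - J12) / 2 * h2
  · rintro ⟨e1, e2⟩
    have k1 : u + v = β * (J11 + J12) / 2 * (Real.tanh u + Real.tanh v) := by
      apply mul_right_cancel₀ hpos.ne'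
      linear_combination e1 - β * (J11 + J12) / 2 * h1
    have k2 : u - v = β * (J11 - J12) / 2 * (Real.tanh u - Real.tanh v) := by
      apply mul_right_cancel₀ hpos.ne'
      linear_combination e2 - β * (J11 - J12) / 2 * h2
    constructor <;> linarith

lemma isCriticalPoint_zero : IsCriticalPoint (symPressure β J11 J12) (0, 0) := by
  have := (isCriticalPoint_tanh_iff β J11 J12 0 0).2 (by simp)
  simpa using this

lemma isCriticalPoint_diag (h : xcoth w = β * (J11 + J12) / 2) :
    IsCriticalPoint (symPressure β J11 J12) (Real.tanh w, Real.tanh w) := by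
  have := xcoth_mul_tanh w
  rw [h] at this
  rw [isCriticalPoint_tanh_iff]
  constructor <;> linarith

lemma isCriticalPoint_antidiag (h : xcoth w = β * (J11 - J12) / 2) :
    IsCriticalPoint (symPressure β J11 J12) (Real.tanh w, Real.tanh (-w)) := by
  have := xcoth_mul_tanh w
  rw [h] at this
  rw [isCriticalPoint_tanh_iff, Real.tanh_neg]
  constructor <;> linarith

lemma cosh_add_cosh_eq {L l P Q : ℝ} (hl : l ≠ 0) (h1 : sinhc Q = L / l * sinhc P)
    (h2 : xcoth P + L / l * xcoth Q = 2 * L) :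
    Real.cosh P + Real.cosh Q = 2 * L * sinhc P ∧
      Real.cosh P + Real.cosh Q = 2 * l * sinhc Q := by
  have h3 : Real.cosh P + Real.cosh Q = 2 * L * sinhc P := by
    rw [← xcoth_mul_sinhc P, ← xcoth_mul_sinhc Q, ← h2, h1]
    ring
  refine ⟨h3, h3.trans ?_⟩
  rw [h1]
  field_simp

lemma isCriticalPoint_off (hl : β * (J11 - J12) / 2 ≠ 0)
    (h1 : sinhc (u - v) = (β * (J11 + J12) / 2) / (β * (J11 - J12) / 2) * sinhc (u + v))
    (h2 : xcoth (u + v) + (β * (J11 + J12) / 2) / (β * (J11 - J12) / 2) * xcoth (u - v)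
      = 2 * (β * (J11 + J12) / 2)) :
    IsCriticalPoint (symPressure β J11 J12) (Real.tanh u, Real.tanh v) := by
  obtain ⟨h3, h4⟩ := cosh_add_cosh_eq hl h1 h2
  rw [isCriticalPoint_tanh_iff']
  exact ⟨by rw [← h3], by rw [← h4]⟩

/-- Since `cosh Q ≥ 1`, `2 L sinhc P ≥ 1 + cosh P = 2 cosh² (P/2) = 2 xcoth (P/2) sinhc P`, so `L ≥
xcoth (P/2) > 1`. -/
lemma one_lt_of_cosh_add_cosh {L P Q : ℝ} (hP : P ≠ 0)
    (h : Real.cosh P + Real.cosh Q = 2 * L * sinhc P) : 1 < L := by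
  have h1 := Real.one_le_cosh Q
  have h2 := xcoth_mul_sinhc_two_mul (P / 2)
  have h3 := cosh_two_mul_add_one (P / 2)
  rw [mul_div_cancel₀ P two_ne_zero] at h2 h3
  have h4 : xcoth (P / 2) ≤ L := by
    apply le_of_mul_le_mul_right _ (sinhc_pos P)
    linarith
  exact (one_lt_xcoth (by positivity)).trans_le h4

/-- Every critical point lies on one of the diagonals or solves the reduced system. -/
lemma IsCriticalPoint.cases
    (hc : IsCriticalPoint (symPressure β J11 J12) (Real.tanh u, Real.tanh v)) :
    (u = 0 ∧ v = 0) ∨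
    (u = v ∧ u ≠ 0 ∧ 1 < β * (J11 + J12) / 2 ∧ xcoth u = β * (J11 + J12) / 2) ∨
    (v = -u ∧ u ≠ 0 ∧ 1 < β * (J11 - J12) / 2 ∧ xcoth u = β * (J11 - J12) / 2) ∨
    (u + v ≠ 0 ∧ u - v ≠ 0 ∧ 1 < β * (J11 - J12) / 2 ∧
      sinhc (u - v) = (β * (J11 + J12) / 2) / (β * (J11 - J12) / 2) * sinhc (u + v) ∧
      xcoth (u + v) + (β * (J11 + J12) / 2) / (β * (J11 - J12) / 2) * xcoth (u - v)
        = 2 * (β * (J11 + J12) / 2)) := by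
  obtain ⟨h1, h2⟩ := isCriticalPoint_tanh_iff'.1 hc
  have h0 := (isCriticalPoint_tanh_iff _ _ _ _ _).1 hc
  have diag : ∀ {L w : ℝ}, w ≠ 0 → w = L * Real.tanh w → xcoth w = L := by
    intro L w hw h
    have h3 := xcoth_mul_tanh w
    have h4 : Real.tanh w ≠ 0 := by
      intro h4
      rw [h4] at h3
      simp at h3
      exact hw h3.symm
    exact mul_right_cancel₀ h4 (h3.trans h)
  by_cases hP : u + v = 0 <;> by_cases hQ : u - v = 0
  · left
    constructor <;> linarith
  · right; right; left
    have hv : v = -u := by linarith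
    subst hv
    have hu : u ≠ 0 := fun h => hQ (by rw [h]; simp)
    have h3 : xcoth u = β * (J11 - J12) / 2 := by
      apply diag hu
      rw [Real.tanh_neg] at h0
      linarith [h0.1]
    exact ⟨rfl, hu, h3 ▸ one_lt_xcoth hu, h3⟩
  · right; left
    have hv : v = u := by linarith
    subst hv
    have hu : v ≠ 0 := fun h => hP (by rw [h]; simp)
    have h3 : xcoth v = β * (J11 + J12) / 2 := by
      apply diag hu
      linarith [h0.1]
    exact ⟨rfl, hu, h3 ▸ one_lt_xcoth hu, h3⟩
  · right; right; right
    replace h1 := mul_left_cancel₀ hP h1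
    replace h2 := mul_left_cancel₀ hQ h2
    have hl : 1 < β * (J11 - J12) / 2 := one_lt_of_cosh_add_cosh hQ (by rw [add_comm]; exact h2)
    have hl0 : β * (J11 - J12) / 2 ≠ 0 := by linarith
    generalize β * (J11 - J12) / 2 = l at *
    generalize β * (J11 + J12) / 2 = L at *
    have h3 : sinhc (u - v) = L / l * sinhc (u + v) := by
      field_simp
      linarith
    refine ⟨hP, hQ, hl, h3, ?_⟩
    apply mul_right_cancel₀ (sinhc_pos (u + v)).ne'
    rw [add_mul, xcoth_mul_sinhc, mul_right_comm, ← h3, mul_comm (sinhc _), xcoth_mul_sinhc]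
    exact h1

/-! ### Nature of the critical points -/

lemma isPositiveMeanFieldSol_tanh {lam : ℝ} (hw : 0 < w) (h : xcoth w = β * lam / 2) :
    IsPositiveMeanFieldSol β lam (Real.tanh w) := by
  refine ⟨tanh_pos hw, ?_⟩
  have := xcoth_mul_tanh w
  rw [h] at this
  rw [show β * lam / 2 * Real.tanh w = w from this]

lemma eq_or_eq_neg_of_xcoth {x y : ℝ} (hy : 0 < y) (h : xcoth x = xcoth y) : x = y ∨ x = -y := by
  rw [← xcoth_abs x] at h
  exact eq_or_eq_neg_of_abs_eq (xcoth_strictMonoOn.injOn (abs_nonneg x) hy.le h)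

lemma xcoth_lt_cosh_sq (hw : w ≠ 0) : xcoth w < Real.cosh w ^ 2 := by
  have h := xcoth_mul_sinhc_two_mul w
  have h1 : 1 < sinhc (2 * w) := one_lt_sinhc (by positivity)
  have h2 := (one_lt_xcoth hw)
  nlinarith

lemma isMaximumPoint_diag (hb : 0 ≤ β * J12) (hw : w ≠ 0) (h : xcoth w = β * (J11 + J12) / 2) :
    IsMaximumPoint (symPressure β J11 J12) (Real.tanh w, Real.tanh w) := by
  have hk : β * J11 / 2 + |β * J12 / 2| < Real.cosh w ^ 2 := by
    rw [abs_of_nonneg (by linarith)]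
    have := xcoth_lt_cosh_sq hw
    linarith
  exact ⟨isCriticalPoint_diag h, isLocalMax_of_lt_cosh_sq (isCriticalPoint_diag h) hk hk⟩

lemma isMaximumPoint_antidiag (hb : 0 ≤ β * J12) (h : xcoth w = β * (J11 - J12) / 2)
    (hL : β * (J11 + J12) / 2 < Real.cosh w ^ 2) :
    IsMaximumPoint (symPressure β J11 J12) (Real.tanh w, Real.tanh (-w)) := by
  have hk : β * J11 / 2 + |β * J12 / 2| < Real.cosh w ^ 2 := by
    rw [abs_of_nonneg (by linarith)]
    linarith
  exact ⟨isCriticalPoint_antidiag h, isLocalMax_of_lt_cosh_sq (isCriticalPoint_antidiag h) hk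
    (by rwa [Real.cosh_neg])⟩

/-- The form is positive along `(1, 1)`, where its eigenvalue is `L - cosh² w`, and negative along
`(1, -1)`, where it is `l - cosh² w` with `l = xcoth w`. -/
lemma isInflectionPoint_antidiag (hw : w ≠ 0) (h : xcoth w = β * (J11 - J12) / 2)
    (hL : Real.cosh w ^ 2 < β * (J11 + J12) / 2) :
    IsInflectionPoint (symPressure β J11 J12) (Real.tanh w, Real.tanh (-w)) := by
  have hc := isCriticalPoint_antidiag h
  refine ⟨hc, fun hmax => ?_, fun hmin => ?_⟩
  · have := hmax.hessian_nonpos hc 1 1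
    rw [Real.cosh_neg] at this
    linarith
  · have := hmin.hessian_nonneg hc 1 (-1)
    rw [Real.cosh_neg] at this
    have := xcoth_lt_cosh_sq hw
    linarith

lemma isMaximumPoint_zero (hb : 0 ≤ β * J12) (hL : β * (J11 + J12) / 2 ≤ 1) :
    IsMaximumPoint (symPressure β J11 J12) (0, 0) := by
  have hc : IsCriticalPoint (symPressure β J11 J12) (Real.tanh 0, Real.tanh 0) := by
    simpa using isCriticalPoint_zero
  have he : ∀ᶠ x in 𝓝 (Real.tanh 0), spinEntropy (Real.tanh 0) + 0 * (x - Real.tanh 0)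
      + 1 / 2 * (x - Real.tanh 0) ^ 2 ≤ spinEntropy x := by
    filter_upwards [isOpen_Ioo.mem_nhds (tanh_mem_Ioo 0)] with x hx
    have := sq_half_le_spinEntropy hx
    simp only [Real.tanh_zero, spinEntropy_zero, sub_zero]
    linarith
  have := isLocalMax_of_forms hc (by rw [abs_of_nonneg (by linarith)]; linarith) he he
  exact ⟨isCriticalPoint_zero, by simpa using this⟩

lemma isInflectionPoint_zero (hL : 1 < β * (J11 + J12) / 2) (hl : β * (J11 - J12) / 2 < 1) :
    IsInflectionPoint (symPressure β J11 J12) (0, 0) := by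
  have hc : IsCriticalPoint (symPressure β J11 J12) (Real.tanh 0, Real.tanh 0) := by
    simpa using isCriticalPoint_zero
  refine ⟨isCriticalPoint_zero, fun hmax => ?_, fun hmin => ?_⟩
  · have := IsLocalMax.hessian_nonpos hc (by simpa using hmax) 1 1
    rw [Real.cosh_zero] at this
    linarith
  · have := IsLocalMin.hessian_nonneg hc (by simpa using hmin) 1 (-1)
    rw [Real.cosh_zero] at this
    linarith

lemma isMinimumPoint_zero (hb : 0 ≤ β * J12) (hl : 1 < β * (J11 - J12) / 2) :
    IsMinimumPoint (symPressure β J11 J12) (0, 0) := by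
  have hc : IsCriticalPoint (symPressure β J11 J12) (Real.tanh 0, Real.tanh 0) := by
    simpa using isCriticalPoint_zero
  have hk : Real.cosh 0 ^ 2 < β * J11 / 2 - |β * J12 / 2| := by
    rw [abs_of_nonneg (by linarith), Real.cosh_zero]
    linarith
  exact ⟨isCriticalPoint_zero, by simpa using isLocalMin_of_cosh_sq_lt hc hk hk⟩

/-- Critical points off the diagonals have an indefinite Hessian. -/
lemma not_isMaximumPoint_off (hl : 0 < β * (J11 - J12) / 2) (hP : u + v ≠ 0) (hQ : u - v ≠ 0)
    (h1 : sinhc (u - v) = (β * (J11 + J12) / 2) / (β * (J11 - J12) / 2) * sinhc (u + v))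
    (h2 : xcoth (u + v) + (β * (J11 + J12) / 2) / (β * (J11 - J12) / 2) * xcoth (u - v)
      = 2 * (β * (J11 + J12) / 2)) :
    ¬ IsMaximumPoint (symPressure β J11 J12) (Real.tanh u, Real.tanh v) := by
  rintro ⟨hc, hmax⟩
  have hdet := hmax.hessian_det_nonneg hc
  obtain ⟨h3, h4⟩ := cosh_add_cosh_eq hl.ne' h1 h2
  have hineq := cosh_sinhc_ineq hP hQ
  have hprod : Real.cosh u ^ 2 * Real.cosh v ^ 2
      = (Real.cosh (u + v) + Real.cosh (u - v)) ^ 2 / 4 := by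
    rw [Real.cosh_add, Real.cosh_sub]; ring
  have hsum : Real.cosh u ^ 2 + Real.cosh v ^ 2
      = 1 + Real.cosh (u + v) * Real.cosh (u - v) := by
    rw [Real.cosh_add, Real.cosh_sub]
    linear_combination (-(Real.cosh v ^ 2 - 1)) * Real.cosh_sq u
      - Real.sinh u ^ 2 * Real.cosh_sq v
  have ha : β * J11 / 2 = (β * (J11 + J12) / 2 + β * (J11 - J12) / 2) / 2 := by ring
  have hb : β * J12 / 2 = (β * (J11 + J12) / 2 - β * (J11 - J12) / 2) / 2 := by ring
  rw [ha, hb] at hdet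
  have hs := sinhc_pos (u + v)
  have ht := sinhc_pos (u - v)
  have hC : 0 < Real.cosh (u + v) + Real.cosh (u - v) :=
    add_pos (Real.cosh_pos _) (Real.cosh_pos _)
  clear h1 h2 ha hb hmax hc
  generalize β * (J11 + J12) / 2 = L at *
  generalize β * (J11 - J12) / 2 = l at *
  -- This is the Hessian determinant, rewritten using `hprod`, `hsum` and `(β J11 / 2)² - (β J12 /
  -- 2)² = L l`.
  have hdet' : 0 ≤ L * l - (L + l) / 2 * (1 + Real.cosh (u + v) * Real.cosh (u - v))
      + (Real.cosh (u + v) + Real.cosh (u - v)) ^ 2 / 4 := by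
    rw [← hprod, ← hsum]
    linarith
  generalize sinhc (u + v) = s at *
  generalize sinhc (u - v) = t at *
  generalize Real.cosh (u + v) = C at *
  generalize Real.cosh (u - v) = D at *
  -- Substituting `L = (C + D) / (2 s)` and `l = (C + D) / (2 t)` leaves the difference whose sign
  -- `cosh_sinhc_ineq` gives.
  have e : (L * l - (L + l) / 2 * (1 + C * D) + (C + D) ^ 2 / 4) * (4 * (s * t))
      = (C + D) * ((C + D) * (1 + s * t) - (s + t) * (1 + C * D)) := by
    have e1 : 2 * L * s = C + D := h3.symm
    have e2 : 2 * l * t = C + D := h4.symm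
    linear_combination (2 * l * t - t * (1 + C * D)) * e1 + ((C + D) - s * (1 + C * D)) * e2
  have h5 := mul_neg_of_pos_of_neg hC (sub_neg.2 hineq)
  rw [← e] at h5
  have := mul_nonneg hdet' (by positivity : 0 ≤ 4 * (s * t))
  linarith

end Critical

/-! ### Reflection symmetry -/

lemma reflectVertical_reflectVertical (p : ℝ × ℝ) :
    reflectVertical (reflectVertical p) = p := by simp [reflectVertical]

lemma symPressure_neg (β J11 J12 : ℝ) :
    symPressure β J11 (-J12) = symPressure β J11 J12 ∘ reflectVertical := by
  ext p
  simp only [Function.comp, symPressure_apply, reflectVertical, spinEntropy_neg]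
  ring

lemma continuous_reflectVertical : Continuous reflectVertical := by
  unfold reflectVertical; fun_prop

section Reflection

variable {β J11 J12 : ℝ} {p : ℝ × ℝ}

lemma IsCriticalPoint.reflect
    (h : IsCriticalPoint (symPressure β J11 J12) (reflectVertical p)) :
    IsCriticalPoint (symPressure β J11 (-J12)) p := by
  obtain ⟨⟨h1, h2⟩, h3⟩ := h
  refine ⟨⟨⟨?_, ?_⟩, h2⟩, ?_⟩
  · have := h1.2
    simp only [reflectVertical] at this
    linarith
  · have := h1.1
    simp only [reflectVertical] at this
    linarith
  · rw [symPressure_neg]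
    have hr : HasFDerivAt reflectVertical
        ((-ContinuousLinearMap.fst ℝ ℝ ℝ).prod (ContinuousLinearMap.snd ℝ ℝ ℝ)) p :=
      (hasFDerivAt_fst (𝕜 := ℝ)).neg.prodMk (hasFDerivAt_snd (𝕜 := ℝ))
    simpa using h3.comp p hr

lemma isCriticalPoint_reflect_iff :
    IsCriticalPoint (symPressure β J11 J12) (reflectVertical p) ↔
      IsCriticalPoint (symPressure β J11 (-J12)) p := by
  refine ⟨IsCriticalPoint.reflect, fun h => ?_⟩
  rw [← reflectVertical_reflectVertical p] at h
  simpa using h.reflect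

lemma isLocalMax_reflect_iff :
    IsLocalMax (symPressure β J11 J12) (reflectVertical p) ↔
      IsLocalMax (symPressure β J11 (-J12)) p := by
  rw [symPressure_neg]
  refine ⟨fun h => h.comp_continuous continuous_reflectVertical.continuousAt, fun h => ?_⟩
  rw [← reflectVertical_reflectVertical p] at h
  have := h.comp_continuous continuous_reflectVertical.continuousAt
  simpa [Function.comp_assoc, Function.comp_def, reflectVertical_reflectVertical] using this

lemma isLocalMin_reflect_iff :
    IsLocalMin (symPressure β J11 J12) (reflectVertical p) ↔
      IsLocalMin (symPressure β J11 (-J12)) p := by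
  rw [symPressure_neg]
  refine ⟨fun h => h.comp_continuous continuous_reflectVertical.continuousAt, fun h => ?_⟩
  rw [← reflectVertical_reflectVertical p] at h
  have := h.comp_continuous continuous_reflectVertical.continuousAt
  simpa [Function.comp_assoc, Function.comp_def, reflectVertical_reflectVertical] using this

lemma isMaximumPoint_reflect_iff :
    IsMaximumPoint (symPressure β J11 J12) (reflectVertical p) ↔
      IsMaximumPoint (symPressure β J11 (-J12)) p :=
  and_congr isCriticalPoint_reflect_iff isLocalMax_reflect_iff

lemma isMinimumPoint_reflect_iff :
    IsMinimumPoint (symPressure β J11 J12) (reflectVertical p) ↔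
      IsMinimumPoint (symPressure β J11 (-J12)) p :=
  and_congr isCriticalPoint_reflect_iff isLocalMin_reflect_iff

lemma isInflectionPoint_reflect_iff :
    IsInflectionPoint (symPressure β J11 J12) (reflectVertical p) ↔
      IsInflectionPoint (symPressure β J11 (-J12)) p :=
  and_congr isCriticalPoint_reflect_iff
    (and_congr (not_congr isLocalMax_reflect_iff) (not_congr isLocalMin_reflect_iff))

lemma criticalSet_eq_image_reflect :
    criticalSet (symPressure β J11 J12)
      = reflectVertical '' criticalSet (symPressure β J11 (-J12)) := by
  ext q
  constructor
  · intro h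
    refine ⟨reflectVertical q, ?_, reflectVertical_reflectVertical q⟩
    change IsCriticalPoint _ _
    rw [← isCriticalPoint_reflect_iff, reflectVertical_reflectVertical]
    exact h
  · rintro ⟨p, h, rfl⟩
    exact isCriticalPoint_reflect_iff.2 h

end Reflection

/-! ### Eigenvalues of the interaction matrix -/

lemma eigenvalueSet_reducedMatrix (J11 J12 : ℝ) :
    eigenvalueSet (reducedMatrix J11 J12 J11) = {J11 + J12, J11 - J12} := by
  have hvec : ∀ {l : ℝ} {v : Fin 2 → ℝ}, v ≠ 0 → (reducedMatrix J11 J12 J11).mulVec v = l • v →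
      l ∈ eigenvalueSet (reducedMatrix J11 J12 J11) := fun hv h =>
    Module.End.hasEigenvalue_of_hasEigenvector
      (Module.End.hasEigenvector_iff.2 ⟨Module.End.mem_eigenspace_iff.2 (by simpa using h), hv⟩)
  ext l
  constructor
  · intro hl
    obtain ⟨v, hv⟩ := Module.End.HasEigenvalue.exists_hasEigenvector hl
    obtain ⟨h1, h2⟩ := Module.End.hasEigenvector_iff.1 hv
    have h3 := Module.End.mem_eigenspace_iff.1 h1
    have e0 := congrFun h3 0
    have e1 := congrFun h3 1
    simp [reducedMatrix, Matrix.mulVec, dotProduct, Fin.sum_univ_two] at e0 e1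
    by_contra hne
    simp only [mem_insert_iff, mem_singleton_iff, not_or] at hne
    have k1 : v 0 + v 1 = 0 :=
      (mul_eq_zero.1 (by linarith : (l - (J11 + J12)) * (v 0 + v 1) = 0)).resolve_left
        (sub_ne_zero.2 hne.1)
    have k2 : v 0 - v 1 = 0 :=
      (mul_eq_zero.1 (by linarith : (l - (J11 - J12)) * (v 0 - v 1) = 0)).resolve_left
        (sub_ne_zero.2 hne.2)
    apply h2
    ext i
    fin_cases i
    · change v 0 = 0; linarith
    · change v 1 = 0; linarith
  · rintro (rfl | rfl)
    · refine hvec (v := ![1, 1]) (fun h => by simpa using congrFun h 0) ?_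
      ext i
      fin_cases i <;> simp [reducedMatrix, add_comm]
    · refine hvec (v := ![1, -1]) (fun h => by simpa using congrFun h 0) ?_
      ext i
      fin_cases i <;> simp [reducedMatrix] <;> ring

/-! ### The threshold equation -/

/-- With `√(1 - c) = tanh t` one has `c = 1 / cosh² t`, and the left side of the threshold equation
becomes `t / (sinh t cosh t) = 1 / sinhc (2t)`. It remains to solve `sinhc (2t) = 1 / r`. -/
lemma exists_isThreshold {r : ℝ} (h0 : 0 < r) (h1 : r < 1) : ∃ c, IsThreshold r c := by
  obtain ⟨t', ht', h⟩ := exists_sinhc_eq (one_le_one_div h0 h1.le)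
  obtain ⟨t, rfl⟩ : ∃ t, t' = 2 * t := ⟨t' / 2, by ring⟩
  have htpos : 0 < t := by
    refine lt_of_le_of_ne (by linarith) ?_
    rintro rfl
    rw [mul_zero, sinhc_zero, eq_div_iff h0.ne'] at h
    linarith
  have h2 := tanh_pos htpos
  have h3 := Real.tanh_lt_one t
  have h4 := one_sub_tanh_sq_mul_cosh_sq t
  have hy : Real.sqrt (1 - (1 - Real.tanh t ^ 2)) = Real.tanh t := by
    rw [sub_sub_cancel, Real.sqrt_sq h2.le]
  refine ⟨1 - Real.tanh t ^ 2, ⟨by nlinarith, by nlinarith⟩, ?_⟩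
  rw [hy, Real.artanh_tanh, div_eq_iff h2.ne']
  have h5 : xcoth t = r * Real.cosh t ^ 2 := by
    rw [← xcoth_mul_sinhc_two_mul, h]
    field_simp
  have h6 := xcoth_mul_tanh t
  rw [h5] at h6
  linear_combination (-(1 - Real.tanh t ^ 2)) * h6 + r * Real.tanh t * h4

lemma IsThreshold.exists_eq {r c : ℝ} (h : IsThreshold r c) :
    ∃ t, 0 < t ∧ c = 1 / Real.cosh t ^ 2 ∧ r * sinhc (2 * t) = 1 := by
  obtain ⟨⟨h0, h1⟩, h⟩ := h
  set y := Real.sqrt (1 - c)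
  have hy : 0 < y := Real.sqrt_pos.2 (by linarith)
  have hy2 : y ^ 2 = 1 - c := Real.sq_sqrt (by linarith)
  have hy1 : y < 1 := by nlinarith
  have ht : Real.tanh (Real.artanh y) = y := Real.tanh_artanh ⟨by linarith, hy1⟩
  have htpos : 0 < Real.artanh y := Real.artanh_pos ⟨hy, hy1⟩
  generalize Real.artanh y = t at *
  rw [div_eq_iff hy.ne'] at h
  have h4 := one_sub_tanh_sq_mul_cosh_sq t
  have h6 := xcoth_mul_tanh t
  have h7 := xcoth_mul_sinhc_two_mul t
  rw [ht, hy2, sub_sub_cancel] at h4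
  have hC : Real.cosh t ≠ 0 := (Real.cosh_pos t).ne'
  refine ⟨t, htpos, by rw [eq_div_iff (pow_ne_zero 2 hC), h4], ?_⟩
  rw [ht] at h6
  have hx : xcoth t * r⁻¹ * r = xcoth t := by
    have : r ≠ 0 := by
      rintro rfl
      rw [zero_mul] at h
      exact (mul_pos h0 htpos).ne' h
    field_simp
  have hx0 : xcoth t ≠ 0 := by
    intro hz
    rw [hz, zero_mul] at h6
    exact htpos.ne h6
  apply mul_left_cancel₀ (mul_ne_zero hx0 hy.ne')
  linear_combination r * y * h7 - Real.cosh t ^ 2 * h + t * h4 - h6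

/-! ### Critical sets in the temperature regimes -/

section Regimes

variable {β J11 J12 : ℝ}

/-- Here `l < L ≤ 1`, whereas every nonzero critical point requires `L > 1` or `l > 1`. -/
lemma criticalSet_of_le_one (hb : 0 < β * J12) (hL : β * (J11 + J12) / 2 ≤ 1) :
    criticalSet (symPressure β J11 J12) = {(0, 0)} := by
  ext p
  constructor
  · intro hp
    obtain ⟨u, v, rfl, -⟩ := (mem_criticalSet_iff _ _ _ _).1 hp
    obtain ⟨rfl, rfl⟩ | ⟨-, -, h, -⟩ | ⟨-, -, h, -⟩ | ⟨-, -, h, -⟩ := IsCriticalPoint.cases hp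
    · simp
    all_goals linarith
  · rintro rfl
    exact isCriticalPoint_zero

lemma mem_diag_of_xcoth {u w : ℝ} (hw : 0 < w) (h : xcoth u = xcoth w) :
    Real.tanh u = Real.tanh w ∨ Real.tanh u = -Real.tanh w := by
  rcases eq_or_eq_neg_of_xcoth hw h with rfl | rfl
  · exact Or.inl rfl
  · exact Or.inr (Real.tanh_neg w)

lemma exists_three_criticalPoints (hb : 0 < β * J12) (hL : 1 < β * (J11 + J12) / 2)
    (hl : β * (J11 - J12) / 2 < 1) :
    ∃ x : ℝ, IsPositiveMeanFieldSol β (J11 + J12) x ∧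
      criticalSet (symPressure β J11 J12) = {(0, 0), (x, x), (-x, -x)} ∧
      (criticalSet (symPressure β J11 J12)).ncard = 3 ∧
      IsInflectionPoint (symPressure β J11 J12) (0, 0) ∧
      IsMaximumPoint (symPressure β J11 J12) (x, x) ∧
      IsMaximumPoint (symPressure β J11 J12) (-x, -x) := by
  obtain ⟨w, hw, hwL⟩ := exists_xcoth_eq hL
  have hx := tanh_pos hw
  have m1 := isMaximumPoint_diag hb.le hw.ne' hwL
  have m2 := isMaximumPoint_diag hb.le (neg_ne_zero.2 hw.ne') ((xcoth_neg w).trans hwL)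
  rw [Real.tanh_neg] at m2
  have hset : criticalSet (symPressure β J11 J12)
      = {(0, 0), (Real.tanh w, Real.tanh w), (-Real.tanh w, -Real.tanh w)} := by
    ext p
    constructor
    · intro hp
      obtain ⟨u, v, rfl, -⟩ := (mem_criticalSet_iff _ _ _ _).1 hp
      obtain ⟨rfl, rfl⟩ | ⟨rfl, -, -, h⟩ | ⟨-, -, h, -⟩ | ⟨-, -, h, -⟩ :=
        IsCriticalPoint.cases hp
      · simp
      · rcases mem_diag_of_xcoth hw (h.trans hwL.symm) with h | h <;> simp [h]
      all_goals linarith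
    · rintro (rfl | rfl | rfl)
      exacts [isCriticalPoint_zero, m1.1, m2.1]
  refine ⟨_, isPositiveMeanFieldSol_tanh hw hwL, hset, ?_, isInflectionPoint_zero hL hl, m1, m2⟩
  rw [hset]
  generalize Real.tanh w = x at *
  rw [ncard_insert_of_notMem, ncard_insert_of_notMem, ncard_singleton] <;>
    simp only [mem_insert_iff, mem_singleton_iff, Prod.mk.injEq, not_or, not_and] <;> grind

/-- Below the threshold, the only critical points lie on the two diagonals. -/
lemma exists_five_criticalPoints (hb : 0 < β * J12) (hl : 1 < β * (J11 - J12) / 2)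
    {t : ℝ} (ht : 0 < t)
    (hr : (J11 - J12) / (J11 + J12) * sinhc (2 * t) = 1)
    (hL : β * (J11 + J12) / 2 < Real.cosh t ^ 2) :
    ∃ x y : ℝ, IsPositiveMeanFieldSol β (J11 + J12) x ∧ IsPositiveMeanFieldSol β (J11 - J12) y ∧
      criticalSet (symPressure β J11 J12)
        = {(0, 0), (x, x), (-x, -x), (y, -y), (-y, y)} ∧
      (criticalSet (symPressure β J11 J12)).ncard = 5 ∧
      IsMinimumPoint (symPressure β J11 J12) (0, 0) ∧
      IsMaximumPoint (symPressure β J11 J12) (x, x) ∧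
      IsMaximumPoint (symPressure β J11 J12) (-x, -x) ∧
      IsInflectionPoint (symPressure β J11 J12) (y, -y) ∧
      IsInflectionPoint (symPressure β J11 J12) (-y, y) := by
  have hL1 : 1 < β * (J11 + J12) / 2 := by linarith
  have hlS : β * (J11 - J12) / 2 * sinhc (2 * t) = β * (J11 + J12) / 2 := by
    have : J11 + J12 ≠ 0 := by
      intro h
      rw [h, mul_zero, zero_div] at hL1
      linarith
    field_simp at hr
    linear_combination β / 2 * hr
  obtain ⟨w, hw, hwL⟩ := exists_xcoth_eq hL1
  obtain ⟨q, hq, hql⟩ := exists_xcoth_eq hl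
  -- After multiplication by `sinhc (2t)`, `xcoth q < xcoth t` reads `L < cosh² t`.
  have hqt : q < t := by
    rw [← xcoth_lt_xcoth hq.le ht.le, hql]
    apply lt_of_mul_lt_mul_right _ (sinhc_pos (2 * t)).le
    rwa [hlS, xcoth_mul_sinhc_two_mul]
  have hqL : Real.cosh q ^ 2 < β * (J11 + J12) / 2 := by
    rw [← hlS, ← xcoth_mul_sinhc_two_mul, hql]
    exact mul_lt_mul_of_pos_left
      ((sinhc_lt_sinhc (by positivity) (by positivity)).2 (by linarith)) (by linarith)
  have hx := tanh_pos hw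
  have hy := tanh_pos hq
  have m1 := isMaximumPoint_diag hb.le hw.ne' hwL
  have m2 := isMaximumPoint_diag hb.le (neg_ne_zero.2 hw.ne') ((xcoth_neg w).trans hwL)
  have m3 := isInflectionPoint_antidiag hq.ne' hql hqL
  have m4 := isInflectionPoint_antidiag (neg_ne_zero.2 hq.ne') ((xcoth_neg q).trans hql)
    (by rwa [Real.cosh_neg])
  rw [neg_neg] at m4
  rw [Real.tanh_neg] at m2 m3 m4
  have hset : criticalSet (symPressure β J11 J12)
      = {(0, 0), (Real.tanh w, Real.tanh w), (-Real.tanh w, -Real.tanh w),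
        (Real.tanh q, -Real.tanh q), (-Real.tanh q, Real.tanh q)} := by
    ext p
    constructor
    · intro hp
      obtain ⟨u, v, rfl, -⟩ := (mem_criticalSet_iff _ _ _ _).1 hp
      obtain ⟨rfl, rfl⟩ | ⟨rfl, -, -, h⟩ | ⟨rfl, -, -, h⟩ | ⟨hP, hQ, -, h1, h2⟩ :=
        IsCriticalPoint.cases hp
      · simp
      · rcases mem_diag_of_xcoth hw (h.trans hwL.symm) with h | h <;> simp [h]
      · rw [Real.tanh_neg]
        rcases mem_diag_of_xcoth hq (h.trans hql.symm) with h | h <;> simp [h]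
      · exfalso
        have hlpos : 0 < β * (J11 - J12) / 2 := by linarith
        have hrr : (β * (J11 + J12) / 2) / (β * (J11 - J12) / 2) = sinhc (2 * t) := by
          rw [div_eq_iff hlpos.ne', ← hlS, mul_comm]
        rw [hrr] at h1 h2
        have hS := sinhc_pos (2 * t)
        -- An off-diagonal point would have `r xcoth (u - v) > r xcoth (2t) = cosh (2t)`, hence `2 L
        -- > 1 + cosh (2t) = 2 cosh² t`, contrary to `hL`.
        have h3 : 2 * t < |u - v| := by
          rw [← sinhc_lt_sinhc (by positivity) (abs_nonneg _), sinhc_abs, h1]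
          exact lt_mul_of_one_lt_right hS (one_lt_sinhc hP)
        have h4 := (xcoth_lt_xcoth (by positivity) (abs_nonneg _)).2 h3
        rw [xcoth_abs] at h4
        have h5 := mul_lt_mul_of_pos_left h4 hS
        rw [mul_comm _ (xcoth (2 * t)), xcoth_mul_sinhc] at h5
        have h6 := cosh_two_mul_add_one t
        have h7 := one_lt_xcoth hP
        linarith
    · rintro (rfl | rfl | rfl | rfl | rfl)
      exacts [isCriticalPoint_zero, m1.1, m2.1, m3.1, m4.1]
  refine ⟨_, _, isPositiveMeanFieldSol_tanh hw hwL, isPositiveMeanFieldSol_tanh hq hql, hset, ?_,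
    isMinimumPoint_zero hb.le hl, m1, m2, m3, m4⟩
  rw [hset]
  generalize Real.tanh w = x at *
  generalize Real.tanh q = y at *
  rw [ncard_insert_of_notMem, ncard_insert_of_notMem, ncard_insert_of_notMem,
    ncard_insert_of_notMem, ncard_singleton] <;>
    simp only [mem_insert_iff, mem_singleton_iff, Prod.mk.injEq, not_or, not_and] <;> grind

/-- Above the threshold, there are four more critical points, off the diagonals. -/
lemma exists_nine_criticalPoints (hb : 0 < β * J12) (hl : 1 < β * (J11 - J12) / 2)
    {t : ℝ} (ht : 0 < t)
    (hr : (J11 - J12) / (J11 + J12) * sinhc (2 * t) = 1)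
    (hL : Real.cosh t ^ 2 < β * (J11 + J12) / 2) :
    ∃ x y z w : ℝ,
      IsPositiveMeanFieldSol β (J11 + J12) x ∧ IsPositiveMeanFieldSol β (J11 - J12) y ∧
      criticalSet (symPressure β J11 J12)
        = {(0, 0), (x, x), (-x, -x), (y, -y), (-y, y),
            (-z, w), (z, -w), (-w, z), (w, -z)} ∧
      (criticalSet (symPressure β J11 J12)).ncard = 9 ∧
      IsMinimumPoint (symPressure β J11 J12) (0, 0) ∧
      IsMaximumPoint (symPressure β J11 J12) (x, x) ∧
      IsMaximumPoint (symPressure β J11 J12) (-x, -x) ∧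
      IsMaximumPoint (symPressure β J11 J12) (y, -y) ∧
      IsMaximumPoint (symPressure β J11 J12) (-y, y) ∧
      ¬ IsMaximumPoint (symPressure β J11 J12) (-z, w) ∧
      ¬ IsMaximumPoint (symPressure β J11 J12) (z, -w) ∧
      ¬ IsMaximumPoint (symPressure β J11 J12) (-w, z) ∧
      ¬ IsMaximumPoint (symPressure β J11 J12) (w, -z) := by
  have hL1 : 1 < β * (J11 + J12) / 2 := by linarith
  have hlpos : 0 < β * (J11 - J12) / 2 := by linarith
  have hlS : β * (J11 - J12) / 2 * sinhc (2 * t) = β * (J11 + J12) / 2 := by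
    have : J11 + J12 ≠ 0 := by
      intro h
      rw [h, mul_zero, zero_div] at hL1
      linarith
    field_simp at hr
    linear_combination β / 2 * hr
  obtain ⟨w, hw, hwL⟩ := exists_xcoth_eq hL1
  obtain ⟨q, hq, hql⟩ := exists_xcoth_eq hl
  have hqt : t < q := by
    rw [← xcoth_lt_xcoth ht.le hq.le, hql]
    apply lt_of_mul_lt_mul_right _ (sinhc_pos (2 * t)).le
    rwa [hlS, xcoth_mul_sinhc_two_mul]
  have hqL : β * (J11 + J12) / 2 < Real.cosh q ^ 2 := by
    rw [← hlS, ← xcoth_mul_sinhc_two_mul, hql]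
    exact mul_lt_mul_of_pos_left
      ((sinhc_lt_sinhc (by positivity) (by positivity)).2 (by linarith)) (by linarith)
  have hrr : (β * (J11 + J12) / 2) / (β * (J11 - J12) / 2) = sinhc (2 * t) := by
    rw [div_eq_iff hlpos.ne', ← hlS, mul_comm]
  have hr1 : 1 < (β * (J11 + J12) / 2) / (β * (J11 - J12) / 2) := by
    rw [hrr]; exact one_lt_sinhc (by positivity)
  obtain ⟨P, Q, hP, hQ, hPQ1, hPQ2⟩ := exists_pair (s := 2 * (β * (J11 + J12) / 2)) hr1 hrr.symm
    (by positivity) (by rw [cosh_two_mul_add_one]; linarith)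
  have hPQ : P < Q := by
    rw [← sinhc_lt_sinhc hP.le hQ.le, hPQ1]
    exact lt_mul_of_one_lt_left (sinhc_pos P) hr1
  have hx := tanh_pos hw
  have hy := tanh_pos hq
  have hz : 0 < Real.tanh ((Q - P) / 2) := tanh_pos (by linarith)
  have hzw : Real.tanh ((Q - P) / 2) < Real.tanh ((P + Q) / 2) := tanh_lt_tanh (by linarith)
  have m1 := isMaximumPoint_diag hb.le hw.ne' hwL
  have m2 := isMaximumPoint_diag hb.le (neg_ne_zero.2 hw.ne') ((xcoth_neg w).trans hwL)
  have m3 := isMaximumPoint_antidiag hb.le hql hqL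
  have m4 := isMaximumPoint_antidiag hb.le ((xcoth_neg q).trans hql) (by rwa [Real.cosh_neg])
  rw [neg_neg] at m4
  rw [Real.tanh_neg] at m2 m3 m4
  -- The reduced system is even in each of `u + v` and `u - v`, so one positive pair `(P, Q)` yields
  -- four points, one per choice of signs.
  have off : ∀ u v : ℝ, |u + v| = P → |u - v| = Q →
      IsCriticalPoint (symPressure β J11 J12) (Real.tanh u, Real.tanh v) ∧
      ¬ IsMaximumPoint (symPressure β J11 J12) (Real.tanh u, Real.tanh v) := by
    rintro u v rfl rfl
    simp only [sinhc_abs, xcoth_abs] at hPQ1 hPQ2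
    exact ⟨isCriticalPoint_off hlpos.ne' hPQ1 hPQ2,
      not_isMaximumPoint_off hlpos (abs_pos.1 hP) (abs_pos.1 hQ) hPQ1 hPQ2⟩
  have o1 := off (-((Q - P) / 2)) ((P + Q) / 2)
    (by rw [show -((Q - P) / 2) + (P + Q) / 2 = P by ring, abs_of_pos hP])
    (by rw [show -((Q - P) / 2) - (P + Q) / 2 = -Q by ring, abs_neg, abs_of_pos hQ])
  have o2 := off ((Q - P) / 2) (-((P + Q) / 2))
    (by rw [show (Q - P) / 2 + -((P + Q) / 2) = -P by ring, abs_neg, abs_of_pos hP])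
    (by rw [show (Q - P) / 2 - -((P + Q) / 2) = Q by ring, abs_of_pos hQ])
  have o3 := off (-((P + Q) / 2)) ((Q - P) / 2)
    (by rw [show -((P + Q) / 2) + (Q - P) / 2 = -P by ring, abs_neg, abs_of_pos hP])
    (by rw [show -((P + Q) / 2) - (Q - P) / 2 = -Q by ring, abs_neg, abs_of_pos hQ])
  have o4 := off ((P + Q) / 2) (-((Q - P) / 2))
    (by rw [show (P + Q) / 2 + -((Q - P) / 2) = P by ring, abs_of_pos hP])
    (by rw [show (P + Q) / 2 - -((Q - P) / 2) = Q by ring, abs_of_pos hQ])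
  rw [Real.tanh_neg] at o1 o2 o3 o4
  have hset : criticalSet (symPressure β J11 J12)
      = {(0, 0), (Real.tanh w, Real.tanh w), (-Real.tanh w, -Real.tanh w),
        (Real.tanh q, -Real.tanh q), (-Real.tanh q, Real.tanh q),
        (-Real.tanh ((Q - P) / 2), Real.tanh ((P + Q) / 2)),
        (Real.tanh ((Q - P) / 2), -Real.tanh ((P + Q) / 2)),
        (-Real.tanh ((P + Q) / 2), Real.tanh ((Q - P) / 2)),
        (Real.tanh ((P + Q) / 2), -Real.tanh ((Q - P) / 2))} := by
    ext p
    constructor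
    · intro hp
      obtain ⟨u, v, rfl, -⟩ := (mem_criticalSet_iff _ _ _ _).1 hp
      obtain ⟨rfl, rfl⟩ | ⟨rfl, -, -, h⟩ | ⟨rfl, -, -, h⟩ | ⟨hP', hQ', -, h1, h2⟩ :=
        IsCriticalPoint.cases hp
      · simp
      · rcases mem_diag_of_xcoth hw (h.trans hwL.symm) with h | h <;> simp [h]
      · rw [Real.tanh_neg]
        rcases mem_diag_of_xcoth hq (h.trans hql.symm) with h | h <;> simp [h]
      · rw [← sinhc_abs (u - v), ← sinhc_abs (u + v)] at h1
        rw [← xcoth_abs (u + v), ← xcoth_abs (u - v)] at h2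
        obtain ⟨eP, eQ⟩ := pair_unique (by linarith) (abs_pos.2 hP') (abs_pos.2 hQ') hP hQ
          h1 h2 hPQ1 hPQ2
        rw [abs_eq hP.le] at eP
        rw [abs_eq hQ.le] at eQ
        rcases eP with eP | eP <;> rcases eQ with eQ | eQ
        · have hu : u = (P + Q) / 2 := by linarith
          have hv : v = -((Q - P) / 2) := by linarith
          simp [hu, hv, Real.tanh_neg]
        · have hu : u = -((Q - P) / 2) := by linarith
          have hv : v = (P + Q) / 2 := by linarith
          simp [hu, hv, Real.tanh_neg]
        · have hu : u = (Q - P) / 2 := by linarith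
          have hv : v = -((P + Q) / 2) := by linarith
          simp [hu, hv, Real.tanh_neg]
        · have hu : u = -((P + Q) / 2) := by linarith
          have hv : v = (Q - P) / 2 := by linarith
          simp [hu, hv, Real.tanh_neg]
    · rintro (rfl | rfl | rfl | rfl | rfl | rfl | rfl | rfl | rfl)
      exacts [isCriticalPoint_zero, m1.1, m2.1, m3.1, m4.1, o1.1, o2.1, o3.1, o4.1]
  refine ⟨_, _, _, _, isPositiveMeanFieldSol_tanh hw hwL, isPositiveMeanFieldSol_tanh hq hql, hset,
    ?_, isMinimumPoint_zero hb.le hl, m1, m2, m3, m4, o1.2, o2.2, o3.2, o4.2⟩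
  rw [hset]
  generalize Real.tanh w = x at *
  generalize Real.tanh q = y at *
  generalize Real.tanh ((Q - P) / 2) = z at *
  generalize Real.tanh ((P + Q) / 2) = w at *
  clear hset m1 m2 m3 m4 o1 o2 o3 o4 off
  rw [ncard_insert_of_notMem, ncard_insert_of_notMem, ncard_insert_of_notMem,
    ncard_insert_of_notMem, ncard_insert_of_notMem, ncard_insert_of_notMem,
    ncard_insert_of_notMem, ncard_insert_of_notMem, ncard_singleton] <;>
    simp only [mem_insert_iff, mem_singleton_iff, Prod.mk.injEq, not_or, not_and] <;> grind

end Regimes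

/-! ### The main theorem -/

theorem mainTheorem3 (J11 J12 lM lm : ℝ) (hsign : 0 < J11 * J12)
    (hM : IsGreatest (eigenvalueSet (reducedMatrix J11 J12 J11)) lM)
    (hm : IsLeast (eigenvalueSet (reducedMatrix J11 J12 J11)) lm) :
    -- the critical points for `J12` are the mirror images of those for `-J12`, of the same nature
    (∀ β : ℝ, 0 < β →
      criticalSet (symPressure β J11 J12)
        = reflectVertical '' criticalSet (symPressure β J11 (-J12)) ∧
      ∀ p : ℝ × ℝ,
        (IsMaximumPoint (symPressure β J11 J12) (reflectVertical p)
          ↔ IsMaximumPoint (symPressure β J11 (-J12)) p) ∧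
        (IsMinimumPoint (symPressure β J11 J12) (reflectVertical p)
          ↔ IsMinimumPoint (symPressure β J11 (-J12)) p) ∧
        (IsInflectionPoint (symPressure β J11 J12) (reflectVertical p)
          ↔ IsInflectionPoint (symPressure β J11 (-J12)) p)) ∧
    -- case 1: both couplings positive
    (0 < J11 → 0 < J12 →
      lM = J11 + J12 ∧ lm = J11 - J12 ∧
      (∀ β : ℝ, 0 < β → β ≤ 2 / lM →
        criticalSet (symPressure β J11 J12) = {(0, 0)} ∧
        IsMaximumPoint (symPressure β J11 J12) (0, 0)) ∧
      (∀ β : ℝ, 2 / lM < β → (lm < 0 ∨ (0 < lm ∧ β < 2 / lm)) →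
        ∃ x : ℝ, IsPositiveMeanFieldSol β lM x ∧
          criticalSet (symPressure β J11 J12) = {(0, 0), (x, x), (-x, -x)} ∧
          (criticalSet (symPressure β J11 J12)).ncard = 3 ∧
          IsInflectionPoint (symPressure β J11 J12) (0, 0) ∧
          IsMaximumPoint (symPressure β J11 J12) (x, x) ∧
          IsMaximumPoint (symPressure β J11 J12) (-x, -x)) ∧
      (0 < lm →
        (∃ c : ℝ, IsThreshold (lm / lM) c) ∧
        ∀ c : ℝ, IsThreshold (lm / lM) c →
          (∀ β : ℝ, 2 / lm < β → β < 2 / (c * lM) →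
            ∃ x y : ℝ, IsPositiveMeanFieldSol β lM x ∧ IsPositiveMeanFieldSol β lm y ∧
              criticalSet (symPressure β J11 J12)
                = {(0, 0), (x, x), (-x, -x), (y, -y), (-y, y)} ∧
              (criticalSet (symPressure β J11 J12)).ncard = 5 ∧
              IsMinimumPoint (symPressure β J11 J12) (0, 0) ∧
              IsMaximumPoint (symPressure β J11 J12) (x, x) ∧
              IsMaximumPoint (symPressure β J11 J12) (-x, -x) ∧
              IsInflectionPoint (symPressure β J11 J12) (y, -y) ∧
              IsInflectionPoint (symPressure β J11 J12) (-y, y)) ∧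
          (∀ β : ℝ, 2 / (c * lM) < β →
            ∃ x y z w : ℝ, IsPositiveMeanFieldSol β lM x ∧ IsPositiveMeanFieldSol β lm y ∧
              criticalSet (symPressure β J11 J12)
                = {(0, 0), (x, x), (-x, -x), (y, -y), (-y, y),
                    (-z, w), (z, -w), (-w, z), (w, -z)} ∧
              (criticalSet (symPressure β J11 J12)).ncard = 9 ∧
              IsMinimumPoint (symPressure β J11 J12) (0, 0) ∧
              IsMaximumPoint (symPressure β J11 J12) (x, x) ∧
              IsMaximumPoint (symPressure β J11 J12) (-x, -x) ∧
              IsMaximumPoint (symPressure β J11 J12) (y, -y) ∧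
              IsMaximumPoint (symPressure β J11 J12) (-y, y) ∧
              ¬ IsMaximumPoint (symPressure β J11 J12) (-z, w) ∧
              ¬ IsMaximumPoint (symPressure β J11 J12) (z, -w) ∧
              ¬ IsMaximumPoint (symPressure β J11 J12) (-w, z) ∧
              ¬ IsMaximumPoint (symPressure β J11 J12) (w, -z)))) ∧
    -- case 2: both couplings negative, `J12` the stronger one
    (J11 < 0 → J12 < -|J11| →
      lM = J11 - J12 ∧ 0 < lM ∧ lm = J11 + J12 ∧ lm < 0 ∧
      (∀ β : ℝ, 0 < β → β < 2 / lM →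
        criticalSet (symPressure β J11 J12) = {(0, 0)} ∧
        IsMaximumPoint (symPressure β J11 J12) (0, 0)) ∧
      (∀ β : ℝ, 2 / lM < β →
        ∃ x : ℝ, IsPositiveMeanFieldSol β lM x ∧
          criticalSet (symPressure β J11 J12) = {(0, 0), (x, -x), (-x, x)} ∧
          (criticalSet (symPressure β J11 J12)).ncard = 3 ∧
          IsInflectionPoint (symPressure β J11 J12) (0, 0) ∧
          IsMaximumPoint (symPressure β J11 J12) (x, -x) ∧
          IsMaximumPoint (symPressure β J11 J12) (-x, x))) ∧
    -- case 3: both couplings negative, `J11` the stronger one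
    (J11 < 0 → -|J11| < J12 → J12 < 0 →
      lM = J11 - J12 ∧ lM < 0 ∧ lm = J11 + J12 ∧ lm < 0 ∧
      (∀ β : ℝ, 0 < β →
        criticalSet (symPressure β J11 J12) = {(0, 0)} ∧
        IsMaximumPoint (symPressure β J11 J12) (0, 0))) := by
  have hJ : J12 ≠ 0 := fun h => by simp [h] at hsign
  rw [eigenvalueSet_reducedMatrix] at hM hm
  have bM1 : J11 + J12 ≤ lM := hM.2 (by simp)
  have bM2 : J11 - J12 ≤ lM := hM.2 (by simp)
  have bm1 : lm ≤ J11 + J12 := hm.2 (by simp)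
  have bm2 : lm ≤ J11 - J12 := hm.2 (by simp)
  have cM : lM = J11 + J12 ∨ lM = J11 - J12 := hM.1
  have cm : lm = J11 + J12 ∨ lm = J11 - J12 := hm.1
  clear hM hm
  refine ⟨fun β _ => ⟨criticalSet_eq_image_reflect, fun p => ⟨isMaximumPoint_reflect_iff,
    isMinimumPoint_reflect_iff, isInflectionPoint_reflect_iff⟩⟩, ?_, ?_, ?_⟩
  · intro h11 h12
    have eM : lM = J11 + J12 := by rcases cM with h | h <;> linarith
    have em : lm = J11 - J12 := by rcases cm with h | h <;> linarith
    clear cM cm bM1 bM2 bm1 bm2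
    subst eM em
    have hM : 0 < J11 + J12 := by linarith
    refine ⟨rfl, rfl, fun β hβ h => ?_, fun β h h' => ?_, fun hm => ⟨?_, fun c hc => ?_⟩⟩
    · rw [le_div_iff₀ hM] at h
      exact ⟨criticalSet_of_le_one (mul_pos hβ h12) (by linarith),
        isMaximumPoint_zero (mul_pos hβ h12).le (by linarith)⟩
    · have hβ : 0 < β := (by positivity : 0 < 2 / (J11 + J12)).trans h
      rw [div_lt_iff₀ hM] at h
      apply exists_three_criticalPoints (mul_pos hβ h12) (by linarith)
      rcases h' with h' | ⟨h', h''⟩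
      · nlinarith
      · rw [lt_div_iff₀ h'] at h''
        linarith
    · exact exists_isThreshold (div_pos hm hM) ((div_lt_one hM).2 (by linarith))
    · obtain ⟨t, ht, rfl, hr⟩ := hc.exists_eq
      have hC : 0 < Real.cosh t ^ 2 := pow_pos (Real.cosh_pos t) 2
      have he : 2 / (1 / Real.cosh t ^ 2 * (J11 + J12)) = 2 * Real.cosh t ^ 2 / (J11 + J12) := by
        field_simp
      rw [he]
      constructor
      · intro β h h'
        have hβ : 0 < β := (by positivity : 0 < 2 / (J11 - J12)).trans h
        rw [div_lt_iff₀ hm] at h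
        rw [lt_div_iff₀ hM] at h'
        exact exists_five_criticalPoints (mul_pos hβ h12) (by linarith) ht hr (by linarith)
      · intro β h
        have hβ : 0 < β := (by positivity : 0 < 2 * Real.cosh t ^ 2 / (J11 + J12)).trans h
        rw [div_lt_iff₀ hM] at h
        refine exists_nine_criticalPoints (mul_pos hβ h12) ?_ ht hr (by linarith)
        have h1 := xcoth_mul_sinhc_two_mul t
        have h2 := one_lt_xcoth ht.ne'
        have h3 := sinhc_pos (2 * t)
        have h4 : (J11 - J12) * sinhc (2 * t) = J11 + J12 := by
          field_simp at hr
          exact hr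
        -- `l sinhc (2t) = L > cosh² t = xcoth t sinhc (2t) > sinhc (2t)`: beyond the threshold, `l
        -- > 1` is automatic.
        have h5 : 1 * sinhc (2 * t) < β * (J11 - J12) / 2 * sinhc (2 * t) := by
          nlinarith
        exact lt_of_mul_lt_mul_right h5 h3.le
  · intro h11 h12
    rw [abs_of_neg h11] at h12
    have eM : lM = J11 - J12 := by rcases cM with h | h <;> linarith
    have em : lm = J11 + J12 := by rcases cm with h | h <;> linarith
    clear cM cm bM1 bM2 bm1 bm2
    subst eM em
    have hM : 0 < J11 - J12 := by linarith
    have hneg : 0 < -J12 := by linarith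
    refine ⟨rfl, hM, rfl, by linarith, fun β hβ h => ?_, fun β h => ?_⟩
    · rw [lt_div_iff₀ hM] at h
      have hb := mul_pos hβ hneg
      -- The regime lemmas are applied to `-J12 > 0`, for which `L` and `l` exchange roles.
      have hL : β * (J11 + -J12) / 2 ≤ 1 := by linarith
      have h2 := isMaximumPoint_reflect_iff (p := (0, 0)).2 (isMaximumPoint_zero hb.le hL)
      rw [criticalSet_eq_image_reflect, criticalSet_of_le_one hb hL]
      simpa [reflectVertical] using h2
    · have hβ : 0 < β := (by positivity : 0 < 2 / (J11 - J12)).trans h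
      rw [div_lt_iff₀ hM] at h
      obtain ⟨x, hx, hs, hn, h0, h1, h2⟩ := exists_three_criticalPoints (J11 := J11)
        (mul_pos hβ hneg) (by linarith) (by nlinarith)
      have hinj : Function.Injective reflectVertical :=
        Function.Involutive.injective reflectVertical_reflectVertical
      have h0' := isInflectionPoint_reflect_iff.2 h0
      have h1' := isMaximumPoint_reflect_iff.2 h1
      have h2' := isMaximumPoint_reflect_iff.2 h2
      simp only [reflectVertical, neg_zero, neg_neg] at h0' h1' h2'
      refine ⟨x, by rwa [sub_eq_add_neg], ?_, ?_, h0', h2', h1'⟩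
      · rw [criticalSet_eq_image_reflect, hs]
        simp only [image_insert_eq, image_singleton, reflectVertical, neg_zero, neg_neg]
        rw [pair_comm]
      · rw [criticalSet_eq_image_reflect, ncard_image_of_injective _ hinj, hn]
  · intro h11 h12 h12'
    rw [abs_of_neg h11] at h12
    have eM : lM = J11 - J12 := by rcases cM with h | h <;> linarith
    have em : lm = J11 + J12 := by rcases cm with h | h <;> linarith
    clear cM cm bM1 bM2 bm1 bm2
    subst eM em
    refine ⟨rfl, by linarith, rfl, by linarith, fun β hβ => ?_⟩
    have hb : 0 < β * -J12 := mul_pos hβ (by linarith)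
    -- Here `J11 < J12`, so the left side is negative for every `β > 0`.
    have hL : β * (J11 + -J12) / 2 ≤ 1 := by nlinarith
    have h2 := isMaximumPoint_reflect_iff (p := (0, 0)).2 (isMaximumPoint_zero hb.le hL)
    rw [criticalSet_eq_image_reflect, criticalSet_of_le_one hb hL]
    simpa [reflectVertical] using h2
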